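/- Let $m>0$, $H_0>0$, $r_0\ge 2m$, and consider the exterior Schwarzschild spacetime with metric $$g=-\Bigl(1-\frac{2m}{r}\Bigr)dt^2+\Bigl(1-\frac{2m}{r}\Bigr)^{-1}dr^2+r^2\sigma ,\qquad r>2m,$$ where $\sigma$ is the standard metric of the unit sphere $\mathbb S^2$, and $\partial_t$ is future pointing. Let $r_*=r+2m\log\bigl(\frac{r}{2m}-1\bigr)$. Let $f$ be a smooth function on $\mathbb S^2$ and put $$\phi=\tfrac12\bigl(H_0^{-2}+|\nabla f|^2\bigr),\qquad \psi=\tfrac12\bigl(H_0^{-2}\Delta f+\langle\nabla|\nabla f|^2,\nabla f\rangle\bigr),$$ with gradient, Laplacian and inner product taken on the standard $\mathbb S^2$. Let $u(\mathbf y,r)$ be a $C^2$ function on $\{\mathbf y\in\mathbb S^2,\ r>r_0\}$ whose graph $t=u(\mathbf y,r)$ is a spacelike hypersurface of constant mean curvature $H_0$ (the mean curvature being the average of the three principal curvatures with respect to the future pointing unit normal $\mathbf n$, with second fundamental form $K(X,Y)=-g(\nabla_XY,\mathbf n)$), and such that $u(\mathbf y,r)-r_*\to f(\mathbf y)$ as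 $r\to\infty$ for every $\mathbf y\in\mathbb S^2$. Write $$E(\mathbf y,r)=u(\mathbf y,r)-r_*-\Bigl(f(\mathbf y)+r^{-1}\phi(\mathbf y)+\tfrac12 r^{-2}\psi(\mathbf y)\Bigr).$$ (a) If there are $C>0$ and a sequence $r_i>r_0$ with $r_i\to\infty$ such that $E(\mathbf y,r_i)\le C r_i^{-3}$ for all $i$ and all $\mathbf y\in\mathbb S^2$, then there are $C'>0$ and $R\ge r_0$ such that $E(\mathbf y,r)\le C' r^{-3}$ for all $r>R$ and all $\mathbf y\in\mathbb S^2$. (b) If there are $C>0$ and a sequence $r_i>r_0$ with $r_i\to\infty$ such that $E(\mathbf y,r_i)\ge -C r_i^{-3}$ for all $i$ and all $\mathbf y\in\mathbb S^2$, then there are $C'>0$ and $R\ge r_0$ such that $E(\mathbf y,r)\ge -C' r^{-3}$ for all $r>R$ and all $\mathbf y\in\mathbb S^2$. -/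

import Mathlib

open scoped Manifold ContDiff

/-- Euclidean three-space, with coordinates `x = (x¹, x², x³)`. -/
abbrev R3 : Type := EuclideanSpace ℝ (Fin 3)

/-- The unit sphere `𝕊²` of Euclidean three-space. -/
abbrev S2 : Type := Metric.sphere (0 : R3) 1

/-- Coordinates `p = (t, x¹, x², x³)` of an event, `t = p 0` and `xⁱ = p i.succ`. -/
abbrev Event : Type := Fin 4 → ℝ

instance factFinrankR3 : Fact (Module.finrank ℝ R3 = 2 + 1) :=
  ⟨finrank_euclideanSpace_fin⟩

/-! ### Calculus on the round sphere -/

lemma inv_norm_smul_mem_S2 {x : R3} (hx : x ≠ 0) : ‖x‖⁻¹ • x ∈ Metric.sphere (0 : R3) 1 := by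
  have h : ‖x‖ ≠ 0 := norm_ne_zero_iff.mpr hx
  simp [norm_smul, h]

open Classical in
/-- The extension of `f : 𝕊² → ℝ` to `ℝ³ ∖ {0}` that is constant along rays,
`x ↦ f (x / |x|)` (with the irrelevant value `0` at the origin). -/
noncomputable def radialExt (f : S2 → ℝ) (x : R3) : ℝ :=
  if hx : x ≠ 0 then f ⟨‖x‖⁻¹ • x, inv_norm_smul_mem_S2 hx⟩ else 0

/-- The gradient `∇f` for the round metric of `𝕊²`, as a vector of `ℝ³` tangent to `𝕊²` at `y`.
The radial derivative of the radially constant extension vanishes, so its Euclidean gradient at a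
point of `𝕊²` is the tangential gradient. -/
noncomputable def sphereGrad (f : S2 → ℝ) (y : S2) : R3 :=
  gradient (radialExt f) (y : R3)

/-- The Laplacian of the round metric of `𝕊²`: the spherical part of the Euclidean Laplacian
`∂ᵣ² + 2 r⁻¹ ∂ᵣ + r⁻² Δ_{𝕊²}`. -/
noncomputable def sphereLaplacian (f : S2 → ℝ) (y : S2) : ℝ :=
  Laplacian.laplacian (radialExt f) (y : R3)

/-- `φ = ½ (H₀⁻² + |∇f|²)`. -/
noncomputable def phi (H₀ : ℝ) (f : S2 → ℝ) (y : S2) : ℝ :=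
  (1 / 2) * ((H₀ ^ 2)⁻¹ + ‖sphereGrad f y‖ ^ 2)

/-- `ψ = ½ (H₀⁻² Δf + ⟨∇|∇f|², ∇f⟩)`. -/
noncomputable def psi (H₀ : ℝ) (f : S2 → ℝ) (y : S2) : ℝ :=
  (1 / 2) * ((H₀ ^ 2)⁻¹ * sphereLaplacian f y +
    inner ℝ (sphereGrad (fun z => ‖sphereGrad f z‖ ^ 2) y) (sphereGrad f y))

/-! ### The Schwarzschild metric -/

/-- `r_* = r + 2m log (r / (2m) - 1)`. -/
noncomputable def rStar (m r : ℝ) : ℝ := r + 2 * m * Real.log (r / (2 * m) - 1)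

/-- The area radius `r = |x|` of an event. -/
noncomputable def radius (p : Event) : ℝ := Real.sqrt (∑ i : Fin 3, p i.succ ^ 2)

/-- The Schwarzschild metric `-h dt² + h⁻¹ dr² + r² σ`, `h = 1 - 2m/r`, as the matrix of its
components in the coordinates `(t, x¹, x², x³)`, `xⁱ` being the Cartesian coordinates belonging to
the spherical coordinates `(r, y)`:
`g_tt = -h`, `g_ti = 0`, `g_ij = δ_ij + (h⁻¹ - 1) xⁱ xʲ / r²`. -/
noncomputable def schwarzschild (m : ℝ) (p : Event) : Matrix (Fin 4) (Fin 4) ℝ :=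
  let h : ℝ := 1 - 2 * m / radius p
  Matrix.of (Fin.cons (Fin.cons (-h) (fun _ => 0))
    (fun i => Fin.cons 0
      (fun j => (if i = j then 1 else 0) + (h⁻¹ - 1) * (p i.succ * p j.succ / radius p ^ 2))))

/-- The inner product `g(v, w)` at the event `p`. -/
noncomputable def gSch (m : ℝ) (p : Event) (v w : Fin 4 → ℝ) : ℝ :=
  ∑ a, ∑ b, schwarzschild m p a b * v a * w b

/-- The partial derivative `∂_c g_ab` at `p`. -/
noncomputable def dMetric (m : ℝ) (p : Event) (c a b : Fin 4) : ℝ :=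
  fderiv ℝ (fun q : Event => schwarzschild m q a b) p (Pi.single c 1)

/-- The Christoffel symbols of the first kind of the Levi-Civita connection,
`Γ_{d,bc} = g(∇_{∂_b} ∂_c, ∂_d) = ½ (∂_b g_dc + ∂_c g_db - ∂_d g_bc)`. -/
noncomputable def christoffel (m : ℝ) (p : Event) (d b c : Fin 4) : ℝ :=
  (1 / 2) * (dMetric m p b d c + dMetric m p c d b - dMetric m p d b c)

/-! ### Graphs `t = u(x)` -/

/-- The parametrization `x ↦ (u(x), x)` of the graph of `u`. -/
noncomputable def graphMap (u : R3 → ℝ) (x : R3) : Event :=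
  Fin.cons (u x) (fun i => x i)

/-- The coordinate tangent vectors `e_i = ∂_i (graphMap u)` of the graph. -/
noncomputable def tangentVec (u : R3 → ℝ) (i : Fin 3) (x : R3) : Fin 4 → ℝ :=
  fderiv ℝ (graphMap u) x (EuclideanSpace.single i 1)

/-- The coordinate derivative `∂_i e_j` along the graph. -/
noncomputable def dTangentVec (u : R3 → ℝ) (i j : Fin 3) (x : R3) : Fin 4 → ℝ :=
  fderiv ℝ (tangentVec u j) x (EuclideanSpace.single i 1)

/-- The components `γ_ij = g(e_i, e_j)` of the metric induced on the graph. -/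
noncomputable def inducedMetric (m : ℝ) (u : R3 → ℝ) (x : R3) : Matrix (Fin 3) (Fin 3) ℝ :=
  Matrix.of fun i j => gSch m (graphMap u x) (tangentVec u i x) (tangentVec u j x)

/-- `n` is the unit timelike normal of the graph at the point over `x` that is future pointing,
`∂_t` being future pointing. For a spacelike graph it exists and is unique. -/
structure IsFutureUnitNormal (m : ℝ) (u : R3 → ℝ) (x : R3) (n : Fin 4 → ℝ) : Prop where
  orthogonal : ∀ i, gSch m (graphMap u x) n (tangentVec u i x) = 0
  unit : gSch m (graphMap u x) n n = -1
  future : gSch m (graphMap u x) n (Pi.single 0 1) < 0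

/-- The components `K_ij = -g(∇_{e_i} e_j, n)` of the second fundamental form of the graph with
respect to the normal `n`, where
`g(∇_{e_i} e_j, n) = g(∂_i e_j, n) + Γ_{d,bc} n^d e_i^b e_j^c`. -/
noncomputable def secondFundForm (m : ℝ) (u : R3 → ℝ) (x : R3) (n : Fin 4 → ℝ) :
    Matrix (Fin 3) (Fin 3) ℝ :=
  Matrix.of fun i j =>
    -(gSch m (graphMap u x) (dTangentVec u i j x) n +
      ∑ d, ∑ b, ∑ c, christoffel m (graphMap u x) d b c * n d *
        tangentVec u i x b * tangentVec u j x c)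

/-- At the point over `x` the graph of `u` has mean curvature `H` with respect to the future
pointing unit normal; the mean curvature is the average `⅓ γ^{ij} K_ij` of the principal
curvatures. -/
def HasMeanCurvatureAt (m : ℝ) (u : R3 → ℝ) (x : R3) (H : ℝ) : Prop :=
  ∃ n : Fin 4 → ℝ, IsFutureUnitNormal m u x n ∧
    (1 / 3) * ((inducedMetric m u x)⁻¹ * secondFundForm m u x n).trace = H

/-- The graph `t = u(x)`, `|x| > r₀`, is a (twice continuously differentiable) spacelike
hypersurface of the Schwarzschild spacetime of constant mean curvature `H₀`. -/
structure IsSpacelikeCMCGraph (m r₀ H₀ : ℝ) (u : R3 → ℝ) : Prop where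
  contDiffOn : ContDiffOn ℝ 2 u {x : R3 | r₀ < ‖x‖}
  spacelike : ∀ x : R3, r₀ < ‖x‖ → (inducedMetric m u x).PosDef
  cmc : ∀ x : R3, r₀ < ‖x‖ → HasMeanCurvatureAt m u x H₀

open scoped Topology RealInnerProductSpace

/-! ### The Schwarzschild metric and its Christoffel symbols in coordinates -/

/-! The proof is a comparison argument with explicit barriers. The Schwarzschild metric is static,
so the mean curvature equation of a graph is a quasilinear elliptic equation in the first and second
derivatives of the height function, which itself does not occur. With `w = h⁻¹ - g^{ij} u_i u_j` and
`h = 1 - 2m/r`, it reads `3 H w^{3/2}` = second order part + first order part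
(`HasMeanCurvatureAt.equation`).

The barriers are `r_* + f + φ/r + ψ/(2r²) + A/r³`. In powers of `ε = 1/r`, the quantity `w` of a
barrier is `ε² L` and the right side of the equation is `ε³ P`, where `L` and `P` are regular at `ε
= 0` (`mcOperator_barrier`). The choice of `φ` makes the leading terms satisfy the equation with `H
= H₀`, and the choice of `ψ` does the same at the next order. What remains of `9 H₀² L³ - P²` is
`ε²` times a continuous function on the sphere, up to a positive factor. At `ε = 0` this function is
affine in `A` with slope a positive constant, so by compactness of the sphere `A` large gives a
strict supersolution near infinity and `-A` a strict subsolution (`exists_barrier_threshold`).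

Where `u` minus a barrier has a local maximum, the gradients agree and the Hessians are ordered.
Ellipticity (`mcPrincipal_mono`) then orders the two mean curvatures the wrong way for a strict
supersolution; subsolutions are symmetric. The hypothesis bounds `u` by the barrier on the spheres
of radii `r_i` once `A ≥ C`. The maximum principle on annuli between two such spheres
(`annulus_nonpos`) carries the bound inside, and the outer radius is arbitrarily large. -/

/-- The function `((1 - 2m/r)⁻¹ - 1) / r²`. -/
noncomputable def radialCoeff (m r : ℝ) : ℝ := ((1 - 2 * m / r)⁻¹ - 1) / r ^ 2

/-- The derivative of `radialCoeff m`. -/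
noncomputable def radialCoeffDeriv (m r : ℝ) : ℝ :=
  -(2 * m * (3 * r - 4 * m)) / (r ^ 3 * (r - 2 * m) ^ 2)

lemma radialCoeff_eq {m r : ℝ} (hm : 0 < m) (hr : 2 * m < r) :
    radialCoeff m r = 2 * m / (r ^ 2 * (r - 2 * m)) := by
  have h1 : r ≠ 0 := by linarith
  have h2 : r - 2 * m ≠ 0 := by linarith
  have h3 : 1 - 2 * m / r ≠ 0 := by
    rw [one_sub_div h1]; exact div_ne_zero h2 h1
  unfold radialCoeff
  rw [one_sub_div h1]
  field_simp
  ring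

lemma hasDerivAt_radialCoeff {m r : ℝ} (hm : 0 < m) (hr : 2 * m < r) :
    HasDerivAt (radialCoeff m) (radialCoeffDeriv m r) r := by
  have h1 : r ≠ 0 := by linarith
  have h2 : r - 2 * m ≠ 0 := by linarith
  have h : HasDerivAt (fun r : ℝ => 2 * m / (r ^ 2 * (r - 2 * m))) (radialCoeffDeriv m r) r := by
    have h3 : HasDerivAt (fun r : ℝ => r ^ 2 * (r - 2 * m)) (2 * r * (r - 2 * m) + r ^ 2 * 1) r := by
      have h4 := (hasDerivAt_pow 2 r).mul ((hasDerivAt_id r).sub_const (2 * m))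
      exact h4.congr_deriv (by simp)
    refine ((hasDerivAt_const r (2 * m)).fun_div h3 (by positivity)).congr_deriv ?_
    unfold radialCoeffDeriv
    field_simp
    ring
  refine h.congr_of_eventuallyEq ?_
  filter_upwards [lt_mem_nhds hr] with t ht
  exact radialCoeff_eq hm ht

lemma radius_sq (p : Event) : radius p ^ 2 = p 1 ^ 2 + p 2 ^ 2 + p 3 ^ 2 := by
  unfold radius
  rw [Real.sq_sqrt (Finset.sum_nonneg fun i _ => sq_nonneg _), Fin.sum_univ_three]
  rfl

/-- The spatial inner product of the last three components. -/
noncomputable def spatialDot (v w : Event) : ℝ := v 1 * w 1 + v 2 * w 2 + v 3 * w 3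

lemma hasFDerivAt_coord (p : Event) (i : Fin 4) :
    HasFDerivAt (fun q : Event => q i) (ContinuousLinearMap.proj (R := ℝ) (φ := fun _ : Fin 4 => ℝ) i) p :=
  (ContinuousLinearMap.proj (R := ℝ) (φ := fun _ : Fin 4 => ℝ) i).hasFDerivAt

lemma exists_hasFDerivAt_radius {p : Event} (hp : 0 < radius p) :
    ∃ L : Event →L[ℝ] ℝ, HasFDerivAt radius L p ∧ ∀ v, L v = spatialDot p v / radius p := by
  have h0 : p 1 ^ 2 + p 2 ^ 2 + p 3 ^ 2 ≠ 0 := by rw [← radius_sq]; positivity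
  have e : radius = fun q : Event => Real.sqrt (q 1 ^ 2 + q 2 ^ 2 + q 3 ^ 2) := by
    funext q
    rw [← radius_sq]
    exact (Real.sqrt_sq (Real.sqrt_nonneg _)).symm
  have h := ((((hasFDerivAt_coord p 1).pow 2).fun_add ((hasFDerivAt_coord p 2).pow 2)).fun_add
    ((hasFDerivAt_coord p 3).pow 2)).sqrt h0
  refine ⟨_, by rw [e]; exact h, fun v => ?_⟩
  rw [← radius_sq, show √(radius p ^ 2) = radius p from Real.sqrt_sq hp.le]
  simp [spatialDot]
  field_simp

lemma schwarzschild_zero_zero (m : ℝ) (p : Event) :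
    schwarzschild m p 0 0 = -(1 - 2 * m / radius p) := rfl

lemma schwarzschild_zero_succ (m : ℝ) (p : Event) (i : Fin 3) :
    schwarzschild m p 0 i.succ = 0 := by simp [schwarzschild]

lemma schwarzschild_succ_zero (m : ℝ) (p : Event) (i : Fin 3) :
    schwarzschild m p i.succ 0 = 0 := by simp [schwarzschild]

lemma schwarzschild_succ_succ (m : ℝ) (p : Event) (i j : Fin 3) :
    schwarzschild m p i.succ j.succ =
      (if i = j then 1 else 0) + radialCoeff m (radius p) * (p i.succ * p j.succ) := by
  simp only [schwarzschild, Matrix.of_apply, Fin.cons_succ, radialCoeff]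
  ring

lemma gSch_eq (m : ℝ) (p v w : Event) :
    gSch m p v w = -(1 - 2 * m / radius p) * v 0 * w 0 + spatialDot v w
      + radialCoeff m (radius p) * spatialDot p v * spatialDot p w := by
  have e3 : (2 : Fin 3).succ = 3 := rfl
  unfold gSch spatialDot
  simp only [Fin.sum_univ_succ (n := 3), Fin.sum_univ_three, schwarzschild_zero_zero,
    schwarzschild_zero_succ, schwarzschild_succ_zero, schwarzschild_succ_succ]
  simp [e3]
  ring

lemma dMetric_zero_zero {m : ℝ} {p : Event} (hp : 0 < radius p) (c : Fin 4) :
    dMetric m p c 0 0 = -2 * m / radius p ^ 3 * spatialDot p (Pi.single c 1) := by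
  obtain ⟨L, hL, hv⟩ := exists_hasFDerivAt_radius hp
  have h1 : HasDerivAt (fun r : ℝ => -(1 - 2 * m / r)) (-(2 * m / radius p ^ 2)) (radius p) := by
    have := (((hasDerivAt_inv hp.ne').const_mul (2 * m)).const_sub 1).neg
    exact this.congr_deriv (by field_simp)
  have h2 := h1.comp_hasFDerivAt p hL
  unfold dMetric
  rw [show (fun q : Event => schwarzschild m q 0 0)
    = (fun r : ℝ => -(1 - 2 * m / r)) ∘ radius from rfl, h2.fderiv]
  simp only [smul_apply, hv, smul_eq_mul]
  field_simp

lemma dMetric_zero_succ (m : ℝ) (p : Event) (c : Fin 4) (i : Fin 3) :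
    dMetric m p c 0 i.succ = 0 := by
  simp [dMetric, schwarzschild_zero_succ]

lemma dMetric_succ_zero (m : ℝ) (p : Event) (c : Fin 4) (i : Fin 3) :
    dMetric m p c i.succ 0 = 0 := by
  simp [dMetric, schwarzschild_succ_zero]

lemma dMetric_succ_succ {m : ℝ} {p : Event} (hm : 0 < m) (hp : 2 * m < radius p) (c : Fin 4)
    (i j : Fin 3) :
    dMetric m p c i.succ j.succ =
      radialCoeffDeriv m (radius p) / radius p * spatialDot p (Pi.single c 1)
          * (p i.succ * p j.succ)
        + radialCoeff m (radius p) * ((Pi.single c 1 : Event) i.succ * p j.succ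
          + (Pi.single c 1 : Event) j.succ * p i.succ) := by
  obtain ⟨L, hL, hv⟩ := exists_hasFDerivAt_radius (p := p) (by linarith)
  have h1 := (hasDerivAt_radialCoeff hm hp).comp_hasFDerivAt p hL
  have h2 := (h1.mul ((hasFDerivAt_coord p i.succ).mul (hasFDerivAt_coord p j.succ))).const_add
    (if i = j then 1 else 0)
  unfold dMetric
  have e : (fun q : Event => schwarzschild m q i.succ j.succ) = fun q : Event =>
      (if i = j then 1 else 0) + ((radialCoeff m ∘ radius) q * (q i.succ * q j.succ)) := by
    funext q; exact schwarzschild_succ_succ m q i j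
  rw [e]
  erw [h2.fderiv]
  simp [hv]
  ring

/-- By staticity and spherical symmetry the contraction depends only on the time components and the
spatial products of `p`, `n`, `v`, `w`, so no individual Christoffel symbol is needed later. -/
lemma christoffel_contraction {m : ℝ} {p : Event} (hm : 0 < m) (hp : 2 * m < radius p)
    (n v w : Event) :
    ∑ d, ∑ b, ∑ c, christoffel m p d b c * n d * v b * w c =
      -(m / radius p ^ 3) * (n 0 * (v 0 * spatialDot p w + w 0 * spatialDot p v)
          - spatialDot p n * v 0 * w 0)
        + (1 / 2) * (radialCoeffDeriv m (radius p) / radius p)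
          * spatialDot p n * spatialDot p v * spatialDot p w
        + radialCoeff m (radius p) * spatialDot v w * spatialDot p n := by
  have e3 : (2 : Fin 3).succ = 3 := rfl
  unfold christoffel
  simp only [Fin.sum_univ_succ (n := 3), Fin.sum_univ_three,
    dMetric_zero_zero (m := m) (p := p) (by linarith), dMetric_zero_succ, dMetric_succ_zero,
    dMetric_succ_succ hm hp]
  simp [spatialDot, e3]
  ring

/-! ### Second order jets -/

/-- `u` has gradient `g` and Hessian (as an endomorphism) `B` at `x`, the gradient existing near
`x`. -/
def HasJet2 (u : R3 → ℝ) (x g : R3) (B : R3 →L[ℝ] R3) : Prop :=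
  ∃ G : R3 → R3, (∀ᶠ z in 𝓝 x, HasGradientAt u (G z) z) ∧ G x = g ∧ HasFDerivAt G B x

/-- The trace of an endomorphism of `ℝ³`. -/
noncomputable def trace3 (B : R3 →L[ℝ] R3) : ℝ := ∑ i : Fin 3, B (EuclideanSpace.single i 1) i

/-- The quantity `h⁻¹ - g^{ij} u_i u_j` of a graph with gradient `g` at `x`. -/
noncomputable def lapseSq (m : ℝ) (x g : R3) : ℝ :=
  (1 - 2 * m / ‖x‖)⁻¹ - ‖g‖ ^ 2 + 2 * m / ‖x‖ ^ 3 * ⟪x, g⟫ ^ 2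

/-- The vector `g^{ij} u_j` of a graph with gradient `g` at `x`. -/
noncomputable def raisedGrad (m : ℝ) (x g : R3) : R3 := g - (2 * m / ‖x‖ ^ 3 * ⟪x, g⟫) • x

/-- The first order part of the mean curvature operator. -/
noncomputable def mcLower (m : ℝ) (x g : R3) : ℝ :=
  -2 * m / ‖x‖ ^ 3 * ⟪x, g⟫ * lapseSq m x g
    + m / ‖x‖ ^ 2 * ((1 - 2 * m / ‖x‖)⁻¹ * ⟪x, g⟫ / ‖x‖
      + (1 - 2 * m / ‖x‖) * ⟪x, g⟫ ^ 3 / ‖x‖ ^ 3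
      - 2 * ⟪x, g⟫ / ‖x‖ * (‖g‖ ^ 2 - ⟪x, g⟫ ^ 2 / ‖x‖ ^ 2))

/-- The second order part of the mean curvature operator. -/
noncomputable def mcPrincipal (m : ℝ) (x g : R3) (B : R3 →L[ℝ] R3) : ℝ :=
  lapseSq m x g * (trace3 B - 2 * m / ‖x‖ ^ 3 * ⟪B x, x⟫)
    + ⟪B (raisedGrad m x g), raisedGrad m x g⟫

/-! ### Linear algebra of rank one perturbations, and the mean curvature equation -/

/-- The trace of `1 - c x xᵀ + w V Vᵀ` against a matrix. -/
lemma trace_one_sub_vecMulVec_mul (c w : ℝ) (x V : Fin 3 → ℝ) (M : Matrix (Fin 3) (Fin 3) ℝ) :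
    ((1 - c • Matrix.vecMulVec x x + w • Matrix.vecMulVec V V) * M).trace =
      M.trace - c * (x ⬝ᵥ M.mulVec x) + w * (V ⬝ᵥ M.mulVec V) := by
  simp [Matrix.trace, Matrix.mul_apply, Matrix.vecMulVec_apply, Fin.sum_univ_three, dotProduct,
    Matrix.mulVec, Matrix.one_apply]
  ring

lemma dotProduct_mulVec_rankOne_sum (a b c d e : ℝ) (D : Matrix (Fin 3) (Fin 3) ℝ)
    (x g z : Fin 3 → ℝ) :
    z ⬝ᵥ (a • D + b • (Matrix.vecMulVec g x + Matrix.vecMulVec x g) + c • Matrix.vecMulVec g g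
      + d • Matrix.vecMulVec x x + e • (1 : Matrix (Fin 3) (Fin 3) ℝ)).mulVec z =
    a * (z ⬝ᵥ D.mulVec z) + 2 * b * (z ⬝ᵥ g) * (z ⬝ᵥ x) + c * (z ⬝ᵥ g) ^ 2 + d * (z ⬝ᵥ x) ^ 2
      + e * (z ⬝ᵥ z) := by
  simp [Matrix.vecMulVec_apply, Fin.sum_univ_three, dotProduct, Matrix.mulVec, Matrix.one_apply]
  ring

lemma trace_rankOne_sum (a b c d e : ℝ) (D : Matrix (Fin 3) (Fin 3) ℝ) (x g : Fin 3 → ℝ) :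
    (a • D + b • (Matrix.vecMulVec g x + Matrix.vecMulVec x g) + c • Matrix.vecMulVec g g
      + d • Matrix.vecMulVec x x + e • (1 : Matrix (Fin 3) (Fin 3) ℝ)).trace =
    a * D.trace + 2 * b * (x ⬝ᵥ g) + c * (g ⬝ᵥ g) + d * (x ⬝ᵥ x) + e * 3 := by
  simp [Matrix.trace, Matrix.vecMulVec_apply, Fin.sum_univ_three, dotProduct]
  ring

/-- This is Sherman–Morrison applied twice. The spatial metric `1 + k x xᵀ` has inverse `1 - c x
xᵀ`, which sends `g` to `V`. Subtracting `h g gᵀ` then adds `h V Vᵀ / (1 - h g·V)` to the inverse,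
and `1 - h g·V = h w`. -/
lemma inv_one_add_vecMulVec {c h k w : ℝ} {x g V : Fin 3 → ℝ}
    (hx : h = 1 - c * (x ⬝ᵥ x)) (hk : k * h = c) (h0 : h ≠ 0) (w0 : w ≠ 0)
    (hV : V = g - (c * (x ⬝ᵥ g)) • x) (hw : w = h⁻¹ - g ⬝ᵥ g + c * (x ⬝ᵥ g) ^ 2) :
    (1 + k • Matrix.vecMulVec x x - h • Matrix.vecMulVec g g)⁻¹ =
      1 - c • Matrix.vecMulVec x x + w⁻¹ • Matrix.vecMulVec V V := by
  refine Matrix.inv_eq_right_inv ?_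
  have a1 : x ⬝ᵥ V = h * (x ⬝ᵥ g) := by
    rw [hV, dotProduct_sub, dotProduct_smul, hx, smul_eq_mul]; ring
  have a2 : g ⬝ᵥ V = h⁻¹ - w := by
    rw [hV, dotProduct_sub, dotProduct_smul, hw, smul_eq_mul, dotProduct_comm g x]; ring
  have a3 : g ⬝ᵥ x = x ⬝ᵥ g := dotProduct_comm _ _
  have a4 : c * (x ⬝ᵥ x) = 1 - h := by linarith
  have hV' : ∀ i, V i = g i - c * (x ⬝ᵥ g) * x i := fun i => by rw [hV]; simp
  simp only [add_mul, sub_mul, mul_add, mul_sub, one_mul, mul_one, Matrix.smul_mul,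
    Matrix.mul_smul, Matrix.vecMulVec_mul_vecMulVec, a1, a2, a3]
  ext i j
  simp only [Matrix.add_apply, Matrix.sub_apply, Matrix.smul_apply, Matrix.vecMulVec_apply,
    smul_eq_mul, Pi.smul_apply]
  have b1 : w⁻¹ * w = 1 := inv_mul_cancel₀ w0
  have b2 : h * h⁻¹ = 1 := mul_inv_cancel₀ h0
  rw [hV' i]
  linear_combination (-k * x i * x j) * a4 + (x i * x j + w⁻¹ * (x ⬝ᵥ g) * x i * V j) * hk
    + (h * g i * V j) * b1 - w⁻¹ * g i * V j * b2 + h * g i * hV' j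

lemma HasGradientAt.tangentVec_eq {u : R3 → ℝ} {g x : R3} (hu : HasGradientAt u g x) (i : Fin 3) :
    tangentVec u i x = Fin.cons (g i) (Pi.single i 1) := by
  have h : HasFDerivAt (graphMap u) (ContinuousLinearMap.pi
      (Fin.cons (innerSL ℝ g) (fun j => EuclideanSpace.proj j : Fin 3 → R3 →L[ℝ] ℝ))) x := by
    rw [hasFDerivAt_pi]
    intro a
    refine Fin.cases ?_ (fun j => ?_) a
    · exact hu.hasFDerivAt
    · exact (EuclideanSpace.proj j : R3 →L[ℝ] ℝ).hasFDerivAt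
  unfold tangentVec
  rw [h.fderiv]
  funext a
  refine Fin.cases ?_ (fun j => ?_) a
  · simp [EuclideanSpace.inner_single_right]
  · simp [Pi.single_apply]

lemma HasJet2.dTangentVec {u : R3 → ℝ} {g x : R3} {B : R3 →L[ℝ] R3} (hu : HasJet2 u x g B)
    (i j : Fin 3) :
    dTangentVec u i j x = Fin.cons (B (EuclideanSpace.single i 1) j) 0 := by
  obtain ⟨G, hG, -, hB⟩ := hu
  have h : HasFDerivAt (tangentVec u j) (ContinuousLinearMap.pi
      (Fin.cons ((EuclideanSpace.proj j : R3 →L[ℝ] ℝ).comp B)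
        (fun _ => 0 : Fin 3 → R3 →L[ℝ] ℝ))) x := by
    have e : tangentVec u j =ᶠ[𝓝 x] fun z => Fin.cons (G z j) (Pi.single j 1) := by
      filter_upwards [hG] with z hz using HasGradientAt.tangentVec_eq hz j
    refine HasFDerivAt.congr_of_eventuallyEq ?_ e
    rw [hasFDerivAt_pi]
    intro a
    refine Fin.cases ?_ (fun l => ?_) a
    · exact (EuclideanSpace.proj j : R3 →L[ℝ] ℝ).hasFDerivAt.comp x hB
    · exact hasFDerivAt_const _ _
  unfold _root_.dTangentVec
  rw [h.fderiv]
  funext a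
  refine Fin.cases ?_ (fun l => ?_) a <;> simp

lemma radius_graphMap (u : R3 → ℝ) (x : R3) : radius (graphMap u x) = ‖x‖ := by
  simp [radius, graphMap, EuclideanSpace.norm_eq]

lemma HasJet2.hasGradientAt {u : R3 → ℝ} {g x : R3} {B : R3 →L[ℝ] R3} (hu : HasJet2 u x g B) :
    HasGradientAt u g x := by
  obtain ⟨G, hG, rfl, -⟩ := hu
  exact hG.self_of_nhds

lemma inner_eq_dotProduct (v w : R3) : ⟪v, w⟫ = v.ofLp ⬝ᵥ w.ofLp := by
  simp [PiLp.inner_apply, dotProduct, mul_comm]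

lemma inner_apply_eq_dotProduct (B : R3 →L[ℝ] R3) (v : R3) :
    ⟪B v, v⟫ = v.ofLp ⬝ᵥ (Matrix.of fun i j => B (EuclideanSpace.single i 1) j).mulVec v.ofLp := by
  have hv : v = ∑ i, v i • EuclideanSpace.single i (1 : ℝ) := by
    ext j; simp [Finset.sum_apply, Pi.single_apply]
  conv_lhs => rw [hv]
  simp only [Fin.sum_univ_three, PiLp.inner_apply, dotProduct, Matrix.mulVec, Matrix.of_apply]
  simp
  ring

/-- The mean curvature equation of a graph, cleared of denominators. -/
theorem HasMeanCurvatureAt.equation {m H : ℝ} {u : R3 → ℝ} {x g : R3} {B : R3 →L[ℝ] R3}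
    (hm : 0 < m) (hx : 2 * m < ‖x‖) (hu : HasJet2 u x g B) (hH : HasMeanCurvatureAt m u x H) :
    0 < lapseSq m x g ∧
      3 * H * (lapseSq m x g * √(lapseSq m x g)) = mcPrincipal m x g B + mcLower m x g := by
  obtain ⟨n, hn, hH⟩ := hH
  have r0 : 0 < ‖x‖ := by linarith
  have hrad := radius_graphMap u x
  obtain ⟨r, hr⟩ : ∃ r, r = ‖x‖ := ⟨_, rfl⟩
  obtain ⟨h, hh⟩ : ∃ h, h = 1 - 2 * m / r := ⟨_, rfl⟩
  obtain ⟨k, hk⟩ : ∃ k, k = radialCoeff m r := ⟨_, rfl⟩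
  obtain ⟨s, hs⟩ : ∃ s, s = ⟪x, g⟫ := ⟨_, rfl⟩
  obtain ⟨q, hq⟩ : ∃ q, q = ‖g‖ ^ 2 := ⟨_, rfl⟩
  obtain ⟨V, hV⟩ : ∃ V, V = raisedGrad m x g := ⟨_, rfl⟩
  obtain ⟨w, hw⟩ : ∃ w, w = lapseSq m x g := ⟨_, rfl⟩
  have hrr : x 0 * x 0 + x 1 * x 1 + x 2 * x 2 = r ^ 2 := by
    rw [hr, EuclideanSpace.norm_sq_eq, Fin.sum_univ_three]; simp; ring
  have hss : x 0 * g 0 + x 1 * g 1 + x 2 * g 2 = s := by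
    rw [hs, inner_eq_dotProduct, dotProduct, Fin.sum_univ_three]
  have hqq : g 0 * g 0 + g 1 * g 1 + g 2 * g 2 = q := by
    rw [hq, EuclideanSpace.norm_sq_eq, Fin.sum_univ_three]; simp; ring
  have hVi : ∀ i, V i = g i - 2 * m / r ^ 3 * s * x i := fun i => by
    rw [hV, hr, hs]; simp [raisedGrad]
  rw [← hr] at hx r0 hrad
  have h0 : 0 < h := by rw [hh, sub_pos, div_lt_one r0]; exact hx
  have hw' : w = h⁻¹ - q + 2 * m / r ^ 3 * s ^ 2 := by rw [hw, hh, hr, hq, hs]; rfl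
  have hkh : k * h = 2 * m / r ^ 3 := by
    rw [hk, radialCoeff, ← hh]; field_simp; rw [hh]; field_simp; ring
  have hhr : h = 1 - 2 * m / r ^ 3 * r ^ 2 := by rw [hh]; field_simp
  have ht : ∀ i, tangentVec u i x = Fin.cons (g i) (Pi.single i 1) :=
    HasGradientAt.tangentVec_eq hu.hasGradientAt
  have hd := hu.dTangentVec
  have p1 : graphMap u x 1 = x 0 := rfl
  have p2 : graphMap u x 2 = x 1 := rfl
  have p3 : graphMap u x 3 = x 2 := rfl
  have dot_single : ∀ (p : Event) (a : ℝ) (i : Fin 3),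
      spatialDot p (Fin.cons a (Pi.single i 1)) = p i.succ := by
    intro p a i
    change p 1 * (Pi.single i 1 : Fin 3 → ℝ) 0 + p 2 * (Pi.single i 1 : Fin 3 → ℝ) 1
      + p 3 * (Pi.single i 1 : Fin 3 → ℝ) 2 = _
    fin_cases i <;> simp
  obtain ⟨X, hX⟩ : ∃ X, X = spatialDot (graphMap u x) n := ⟨_, rfl⟩
  have o : ∀ i, -h * n 0 * g i + n i.succ + k * X * x i = 0 := by
    intro i
    have := hn.orthogonal i
    rw [gSch_eq, ht, dot_single, dot_single, hrad, ← hh, ← hk, ← hX] at this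
    exact this
  have hX' : X = x 0 * n 1 + x 1 * n 2 + x 2 * n 3 := by rw [hX, spatialDot, p1, p2, p3]
  have o0 : -h * n 0 * g 0 + n 1 + k * X * x 0 = 0 := o 0
  have o1 : -h * n 0 * g 1 + n 2 + k * X * x 1 = 0 := o 1
  have o2 : -h * n 0 * g 2 + n 3 + k * X * x 2 = 0 := o 2
  have hu1 : -h * n 0 * n 0 + (n 1 * n 1 + n 2 * n 2 + n 3 * n 3) + k * X * X = -1 := by
    have := hn.unit
    rw [gSch_eq, hrad, ← hh, ← hk, ← hX] at this
    exact this
  have hn0 : 0 < n 0 := by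
    have := hn.future
    rw [gSch_eq, hrad, ← hh, ← hk] at this
    simp [spatialDot] at this
    exact pos_of_mul_pos_right this h0.le
  -- Contracting the three orthogonality relations with `x` determines the radial part of the
  -- normal; they then give its spatial part as a multiple of the raised gradient `V`.
  have hXs : X = h ^ 2 * n 0 * s := by
    have : X * (1 + k * r ^ 2) = h * n 0 * s := by
      rw [← hrr, ← hss]; linear_combination hX' + x 0 * o0 + x 1 * o1 + x 2 * o2
    have h3 : h * (1 + k * r ^ 2) = 1 := by linear_combination r ^ 2 * hkh + hhr
    linear_combination h * this - X * h3
  have hni : ∀ i, n i.succ = h * n 0 * V i := by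
    intro i
    rw [hVi, ← hkh]
    linear_combination o i - k * x i * hXs
  have n1 : n 1 = h * n 0 * V 0 := hni 0
  have n2 : n 2 = h * n 0 * V 1 := hni 1
  have n3 : n 3 = h * n 0 * V 2 := hni 2
  have b2 : h * h⁻¹ = 1 := mul_inv_cancel₀ h0.ne'
  obtain ⟨c, hc⟩ : ∃ c, c = 2 * m / r ^ 3 := ⟨_, rfl⟩
  rw [← hc] at hkh hw' hhr
  simp only [← hc] at hVi
  have hVV : V 0 * V 0 + V 1 * V 1 + V 2 * V 2 = q - c * s ^ 2 - c * h * s ^ 2 := by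
    rw [hVi, hVi, hVi]
    linear_combination hqq - 2 * c * s * hss + c ^ 2 * s ^ 2 * hrr + c * s ^ 2 * hhr
  -- The normalization of `n` forces `w > 0`, and with `n 0 > 0` from the time orientation it gives
  -- `√w = (h * n 0)⁻¹`.
  have hnw : (h * n 0) ^ 2 * w = 1 := by
    rw [n1, n2, n3, hXs] at hu1
    linear_combination -hu1 + (h * n 0) ^ 2 * hVV + (h * n 0) ^ 2 * hw' + h * n 0 ^ 2 * b2
      + h ^ 3 * n 0 ^ 2 * s ^ 2 * hkh
  have hw0 : 0 < w := by
    by_contra hneg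
    have : (h * n 0) ^ 2 * w ≤ 0 := mul_nonpos_of_nonneg_of_nonpos (sq_nonneg _) (not_lt.mp hneg)
    linarith
  rw [← hw]
  refine ⟨hw0, ?_⟩
  have hsqrt : √w = (h * n 0)⁻¹ := by
    rw [Real.sqrt_eq_iff_mul_self_eq hw0.le (by positivity)]
    field_simp
    linear_combination hnw
  obtain ⟨D, hD⟩ : ∃ D : Matrix (Fin 3) (Fin 3) ℝ,
    D = Matrix.of fun i j => B (EuclideanSpace.single i 1) j := ⟨_, rfl⟩
  have hγ : inducedMetric m u x = 1 + k • Matrix.vecMulVec x.ofLp x.ofLp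
      - h • Matrix.vecMulVec g.ofLp g.ofLp := by
    ext i j
    simp only [inducedMetric, Matrix.of_apply, gSch_eq, ht, dot_single, hrad, ← hh, ← hk]
    simp [Matrix.vecMulVec_apply, Matrix.one_apply, Pi.single_apply, graphMap]
    simp only [@eq_comm _ j i]
    ring
  have hK : secondFundForm m u x n = (h * n 0) • D
      + (m / r ^ 3 * n 0) • (Matrix.vecMulVec g.ofLp x.ofLp + Matrix.vecMulVec x.ofLp g.ofLp)
      + (-(m / r ^ 3 * X)) • Matrix.vecMulVec g.ofLp g.ofLp
      + (-(1 / 2 * (radialCoeffDeriv m r / r) * X)) • Matrix.vecMulVec x.ofLp x.ofLp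
      + (-(k * X)) • (1 : Matrix (Fin 3) (Fin 3) ℝ) := by
    ext i j
    have z2 : ∀ a : ℝ, spatialDot (Fin.cons a 0) n = 0 := fun a => by
      change 0 * n 1 + 0 * n 2 + 0 * n 3 = 0; ring
    have z3 : ∀ a : ℝ, spatialDot (graphMap u x) (Fin.cons a 0) = 0 := fun a => by
      change _ * 0 + _ * 0 + _ * 0 = _; ring
    simp only [secondFundForm, Matrix.of_apply]
    rw [christoffel_contraction hm (by rw [hrad]; exact hx), gSch_eq, hd, z2, z3]
    simp only [ht, dot_single, hrad, ← hh, ← hk, ← hX, hD]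
    simp [Matrix.vecMulVec_apply, Matrix.one_apply, Pi.single_apply, graphMap]
    simp only [@eq_comm _ j i]
    ring
  have d1 : x.ofLp ⬝ᵥ x.ofLp = r ^ 2 := by rw [dotProduct, Fin.sum_univ_three, hrr]
  have d2 : x.ofLp ⬝ᵥ g.ofLp = s := by rw [dotProduct, Fin.sum_univ_three, hss]
  have d3 : g.ofLp ⬝ᵥ g.ofLp = q := by rw [dotProduct, Fin.sum_univ_three, hqq]
  have d4 : V.ofLp ⬝ᵥ V.ofLp = q - c * s ^ 2 - c * h * s ^ 2 := by
    rw [dotProduct, Fin.sum_univ_three, hVV]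
  have d5 : V.ofLp ⬝ᵥ g.ofLp = h⁻¹ - w := by
    rw [dotProduct, Fin.sum_univ_three, hVi, hVi, hVi]
    linear_combination hqq - c * s * hss + hw'
  have d6 : V.ofLp ⬝ᵥ x.ofLp = h * s := by
    rw [dotProduct, Fin.sum_univ_three, hVi, hVi, hVi]
    linear_combination hss - c * s * hrr - s * hhr
  have hinv := inv_one_add_vecMulVec (c := c) (h := h) (k := k) (w := w) (x := x.ofLp)
    (g := g.ofLp) (V := V.ofLp) (by rw [d1, hhr]) hkh h0.ne' hw0.ne'
    (by funext i; simpa [d2] using hVi i) (by rw [d2, d3, hw'])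
  rw [hγ, hinv, hK, trace_one_sub_vecMulVec_mul, trace_rankOne_sum, dotProduct_mulVec_rankOne_sum,
    dotProduct_mulVec_rankOne_sum, d1, d2, d3, d4, d5, d6] at hH
  have t1 : D.trace = trace3 B := by rw [hD]; rfl
  have t2 : x.ofLp ⬝ᵥ D.mulVec x.ofLp = ⟪B x, x⟫ := by rw [hD, inner_apply_eq_dotProduct]
  have t3 : V.ofLp ⬝ᵥ D.mulVec V.ofLp = ⟪B V, V⟫ := by rw [hD, inner_apply_eq_dotProduct]
  rw [t1, t2, t3, hXs] at hH
  rw [mcPrincipal, mcLower, ← hV, ← hw, ← hr, ← hs, ← hq, ← hh, ← hc, hsqrt]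
  have hh' : h = (r - 2 * m) / r := by rw [hh]; field_simp
  have hrm : r - 2 * m ≠ 0 := by linarith
  have hn0' := hn0.ne'
  -- These are the Christoffel terms of the traced second fundamental form, divided by `n 0`.
  -- Eliminating `q` through `hw'` leaves a rational identity.
  have key : 2 * (m / r ^ 3) * s - m / r ^ 3 * (h ^ 2 * s) * q
        - 1 / 2 * (radialCoeffDeriv m r / r) * (h ^ 2 * s) * r ^ 2 - k * (h ^ 2 * s) * 3
      - c * (2 * (m / r ^ 3) * s * r ^ 2 - m / r ^ 3 * (h ^ 2 * s) * s ^ 2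
        - 1 / 2 * (radialCoeffDeriv m r / r) * (h ^ 2 * s) * (r ^ 2) ^ 2
        - k * (h ^ 2 * s) * r ^ 2)
      + w⁻¹ * (2 * (m / r ^ 3) * (h⁻¹ - w) * (h * s) - m / r ^ 3 * (h ^ 2 * s) * (h⁻¹ - w) ^ 2
        - 1 / 2 * (radialCoeffDeriv m r / r) * (h ^ 2 * s) * (h * s) ^ 2
        - k * (h ^ 2 * s) * (q - c * s ^ 2 - c * h * s ^ 2))
      = h * w⁻¹ * (-2 * m / r ^ 3 * s * w + m / r ^ 2 * (h⁻¹ * s / r + h * s ^ 3 / r ^ 3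
        - 2 * s / r * (q - s ^ 2 / r ^ 2))) := by
    have hq' : q = h⁻¹ + c * s ^ 2 - w := by linear_combination hw'
    rw [hk, radialCoeff_eq hm hx, hq', hc, hh', radialCoeffDeriv]
    field_simp
    ring
  obtain ⟨L, hL⟩ : ∃ L, L = -2 * m / r ^ 3 * s * w + m / r ^ 2 * (h⁻¹ * s / r + h * s ^ 3 / r ^ 3
        - 2 * s / r * (q - s ^ 2 / r ^ 2)) := ⟨_, rfl⟩
  rw [← hL] at key ⊢
  have hT : 3 * H = h * n 0 * (trace3 B - c * ⟪B x, x⟫ + w⁻¹ * ⟪B V, V⟫)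
      + n 0 * (h * w⁻¹ * L) := by
    linear_combination -3 * hH + n 0 * key
  rw [hT]
  field_simp

/-! ### Calculus of jets -/

lemma HasJet2.hasFDerivAt {u : R3 → ℝ} {x g : R3} {B : R3 →L[ℝ] R3} (hu : HasJet2 u x g B) :
    HasFDerivAt u (innerSL ℝ g) x := hu.hasGradientAt.hasFDerivAt

lemma hasGradientAt_of_hasFDerivAt {u : R3 → ℝ} {x g : R3} {L : R3 →L[ℝ] ℝ}
    (h : HasFDerivAt u L x) (hL : ∀ v, L v = ⟪g, v⟫) : HasGradientAt u g x := by
  have e : InnerProductSpace.toDual ℝ R3 g = L := by ext v; simp [hL]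
  rw [hasGradientAt_iff_hasFDerivAt, e]
  exact h

lemma HasJet2.add {u v : R3 → ℝ} {x g k : R3} {B C : R3 →L[ℝ] R3} (hu : HasJet2 u x g B)
    (hv : HasJet2 v x k C) : HasJet2 (fun z => u z + v z) x (g + k) (B + C) := by
  obtain ⟨G, hG, rfl, hB⟩ := hu
  obtain ⟨K, hK, rfl, hC⟩ := hv
  refine ⟨fun z => G z + K z, ?_, rfl, hB.fun_add hC⟩
  filter_upwards [hG, hK] with z h1 h2
  exact hasGradientAt_of_hasFDerivAt (h1.hasFDerivAt.fun_add h2.hasFDerivAt)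
    fun v => by simp [inner_add_left]

lemma HasJet2.sub {u v : R3 → ℝ} {x g k : R3} {B C : R3 →L[ℝ] R3} (hu : HasJet2 u x g B)
    (hv : HasJet2 v x k C) : HasJet2 (fun z => u z - v z) x (g - k) (B - C) := by
  obtain ⟨G, hG, rfl, hB⟩ := hu
  obtain ⟨K, hK, rfl, hC⟩ := hv
  refine ⟨fun z => G z - K z, ?_, rfl, hB.fun_sub hC⟩
  filter_upwards [hG, hK] with z h1 h2
  exact hasGradientAt_of_hasFDerivAt (h1.hasFDerivAt.fun_sub h2.hasFDerivAt)
    fun v => by simp [inner_sub_left]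

lemma contDiffAt_gradient {u : R3 → ℝ} {x : R3} {n k : ℕ∞ω} (hu : ContDiffAt ℝ n u x)
    (hk : k + 1 ≤ n) : ContDiffAt ℝ k (gradient u) x :=
  ((InnerProductSpace.toDual ℝ R3).symm.contDiff.contDiffAt).comp x (hu.fderiv_right hk)

lemma hasJet2_of_contDiffAt {u : R3 → ℝ} {x : R3} (hu : ContDiffAt ℝ 2 u x) :
    HasJet2 u x (gradient u x) (fderiv ℝ (gradient u) x) := by
  refine ⟨gradient u, ?_, rfl, ?_⟩
  · filter_upwards [hu.eventually (by simp)] with z hz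
    exact (hz.differentiableAt (by simp)).hasGradientAt
  · exact ((contDiffAt_gradient (k := 1) hu (by norm_num)).differentiableAt (by simp)).hasFDerivAt

/-- The second derivative test. -/
lemma HasJet2.of_isLocalMax {w : R3 → ℝ} {x g : R3} {B : R3 →L[ℝ] R3} (hw : HasJet2 w x g B)
    (hmax : IsLocalMax w x) : g = 0 ∧ ∀ v, ⟪B v, v⟫ ≤ 0 := by
  have hg : g = 0 := by
    have h1 := hmax.hasFDerivAt_eq_zero hw.hasFDerivAt
    have h2 : innerSL ℝ g g = 0 := by rw [h1]; rfl
    simpa using h2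
  refine ⟨hg, fun v => ?_⟩
  obtain ⟨G, hG, hGx, hB⟩ := hw
  by_contra! hpos
  have hline : ∀ t : ℝ, HasDerivAt (fun t : ℝ => x + t • v) v t := fun t => by
    simpa using ((hasDerivAt_id t).smul_const v).const_add x
  have hcont : Filter.Tendsto (fun t : ℝ => x + t • v) (𝓝 0) (𝓝 x) := by
    have := (hline 0).continuousAt
    simpa [ContinuousAt] using this
  have hd : ∀ᶠ t in 𝓝 (0 : ℝ), HasDerivAt (fun t : ℝ => w (x + t • v)) ⟪G (x + t • v), v⟫ t := by
    filter_upwards [hcont.eventually hG] with t ht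
    simpa [Function.comp_def] using ht.hasFDerivAt.comp_hasDerivAt t (hline t)
  have hd' : deriv (fun t : ℝ => w (x + t • v)) =ᶠ[𝓝 0] fun t => ⟪G (x + t • v), v⟫ := by
    filter_upwards [hd] with t ht using ht.deriv
  have hB' : HasFDerivAt G B (x + (0 : ℝ) • v) := by simpa using hB
  have hdd : HasDerivAt (fun t : ℝ => ⟪G (x + t • v), v⟫) ⟪B v, v⟫ 0 := by
    have := (hB'.comp_hasDerivAt 0 (hline 0)).inner ℝ (hasDerivAt_const (0 : ℝ) v)
    simpa using this
  have hdd' := hdd.congr_of_eventuallyEq hd'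
  -- A positive second derivative along the line would make `0` a local minimum as well as a local
  -- maximum. The restriction would then be locally constant, with vanishing second derivative.
  have hmin : IsLocalMin (fun t : ℝ => w (x + t • v)) 0 := by
    refine isLocalMin_of_deriv_deriv_pos ?_ ?_ hd.self_of_nhds.continuousAt
    · rw [hdd'.deriv]; exact hpos
    · rw [hd'.self_of_nhds]; simp [hGx, hg]
  have hmax' : ∀ᶠ t in 𝓝 (0 : ℝ), w (x + t • v) ≤ w (x + (0 : ℝ) • v) := by
    have := hcont.eventually hmax
    simpa using this
  have hconst : (fun t : ℝ => w (x + t • v)) =ᶠ[𝓝 0] fun _ => w (x + (0 : ℝ) • v) := by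
    filter_upwards [hmin, hmax'] with t h1 h2 using le_antisymm h2 h1
  have h0 := hconst.deriv.deriv_eq
  rw [hdd'.deriv] at h0
  simp at h0
  linarith

/-- The matrix `1 - c x xᵀ` is positive semidefinite with square root `1 - d x xᵀ`, so the
expression is the sum of the values of the quadratic form of `B` on the vectors `e_i - d x_i x`. -/
lemma trace3_nonpos_of_forall {B : R3 →L[ℝ] R3} (hB : ∀ v, ⟪B v, v⟫ ≤ 0) {x : R3} {c : ℝ}
    (hc : c * ‖x‖ ^ 2 ≤ 1) : trace3 B - c * ⟪B x, x⟫ ≤ 0 := by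
  rcases eq_or_ne x 0 with rfl | hx
  · simp only [map_zero, inner_zero_left, mul_zero, sub_zero]
    refine Finset.sum_nonpos fun i _ => ?_
    simpa [EuclideanSpace.inner_single_right] using hB (EuclideanSpace.single i 1)
  have hx0 : 0 < ‖x‖ ^ 2 := by positivity
  obtain ⟨q, hq⟩ : ∃ q, q = ‖x‖ ^ 2 := ⟨_, rfl⟩
  -- A root of `2 d - d² q = c`, which is the equation `(1 - d x xᵀ)² = 1 - c x xᵀ`; it is real
  -- because `c q ≤ 1`.
  obtain ⟨d, hd⟩ : ∃ d, d = (1 - √(1 - c * q)) / q := ⟨_, rfl⟩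
  rw [← hq] at hx0 hc
  have hs := Real.sq_sqrt (sub_nonneg.mpr hc)
  have hd2 : 2 * d - d ^ 2 * q = c := by
    rw [hd]; field_simp; linear_combination -hs
  have hqs : x 0 ^ 2 + x 1 ^ 2 + x 2 ^ 2 = q := by
    rw [hq, EuclideanSpace.norm_sq_eq, Fin.sum_univ_three]; simp
  have h1 : ∀ i : Fin 3, B (EuclideanSpace.single i 1) i
      - d * x i * ⟪B (EuclideanSpace.single i 1), x⟫ - d * x i * B x i
      + d ^ 2 * x i ^ 2 * ⟪B x, x⟫ ≤ 0 := by
    intro i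
    have := hB (EuclideanSpace.single i 1 - (d * x i) • x)
    simp only [map_sub, map_smul, inner_sub_left, inner_sub_right, inner_smul_left,
      inner_smul_right, EuclideanSpace.inner_single_right] at this
    simp at this
    linarith
  have e1 : ∑ i : Fin 3, x i * ⟪B (EuclideanSpace.single i 1), x⟫ = ⟪B x, x⟫ := by
    have hv : x = ∑ i, x i • EuclideanSpace.single i (1 : ℝ) := by
      ext j; simp [Finset.sum_apply, Pi.single_apply]
    conv_rhs => rw [show B x = ∑ i, x i • B (EuclideanSpace.single i 1) by
      conv_lhs => rw [hv]
      simp only [map_sum, map_smul]]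
    rw [sum_inner]
    simp [inner_smul_left]
  have e2 : ∑ i : Fin 3, x i * B x i = ⟪B x, x⟫ := by
    rw [inner_eq_dotProduct, dotProduct]; simp [mul_comm]
  rw [Fin.sum_univ_three] at e1 e2
  rw [trace3, Fin.sum_univ_three]
  have h3 : c * ⟪B x, x⟫ = 2 * d * ⟪B x, x⟫ - d ^ 2 * q * ⟪B x, x⟫ := by rw [← hd2]; ring
  have h4 : d ^ 2 * q * ⟪B x, x⟫ = d ^ 2 * (x 0 ^ 2 + x 1 ^ 2 + x 2 ^ 2) * ⟪B x, x⟫ := by rw [hqs]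
  rw [h3, h4]
  linear_combination h1 0 + h1 1 + h1 2 + d * e1 + d * e2

/-- This is ellipticity: for a fixed gradient the operator is linear in the Hessian, with
coefficient matrix `w (1 - (2m/|x|³) x xᵀ) + V Vᵀ`. Outside the horizon this is positive
semidefinite. -/
lemma mcPrincipal_mono {m : ℝ} {x g : R3} {B C : R3 →L[ℝ] R3} (hm : 0 < m) (hx : 2 * m < ‖x‖)
    (hw : 0 ≤ lapseSq m x g) (h : ∀ v, ⟪(B - C) v, v⟫ ≤ 0) :
    mcPrincipal m x g B ≤ mcPrincipal m x g C := by
  have r0 : 0 < ‖x‖ := by linarith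
  have h1 := trace3_nonpos_of_forall h (x := x) (c := 2 * m / ‖x‖ ^ 3) (by
    rw [div_mul_eq_mul_div, div_le_one (by positivity)]
    nlinarith [mul_le_mul_of_nonneg_right hx.le (sq_nonneg ‖x‖)])
  have h2 := h (raisedGrad m x g)
  have h3 := mul_nonpos_of_nonneg_of_nonpos hw h1
  have e : trace3 (B - C) = trace3 B - trace3 C := by simp [trace3]
  rw [e] at h3
  simp only [sub_apply, inner_sub_left] at h2 h3
  unfold mcPrincipal
  linarith

lemma hasFDerivAt_norm_of_ne_zero {x : R3} (hx : x ≠ 0) :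
    HasFDerivAt (fun z : R3 => ‖z‖) (‖x‖⁻¹ • innerSL ℝ x) x := by
  have h := (hasStrictFDerivAt_norm_sq x).hasFDerivAt.sqrt (by positivity)
  simp only [Real.sqrt_sq (norm_nonneg _)] at h
  refine h.congr_fderiv ?_
  ext v
  have : ‖x‖ ≠ 0 := by positivity
  simp
  field_simp

/-- The jet of a product of a radial function and a function `c`. -/
lemma HasJet2.radial_mul {α α₁ : ℝ → ℝ} {α₂ : ℝ} {c : R3 → ℝ} {x g : R3} {B : R3 →L[ℝ] R3}
    (hx : x ≠ 0) (hα : ∀ᶠ t in 𝓝 ‖x‖, HasDerivAt α (α₁ t) t) (hα₁ : HasDerivAt α₁ α₂ ‖x‖)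
    (hc : HasJet2 c x g B) :
    ∃ B' : R3 →L[ℝ] R3,
      HasJet2 (fun z => α ‖z‖ * c z) x ((α₁ ‖x‖ * ‖x‖⁻¹ * c x) • x + α ‖x‖ • g) B' ∧
      ∀ v, B' v = ((α₂ * ‖x‖⁻¹ ^ 2 - α₁ ‖x‖ * ‖x‖⁻¹ ^ 3) * ⟪x, v⟫ * c x
            + α₁ ‖x‖ * ‖x‖⁻¹ * ⟪g, v⟫) • x + (α₁ ‖x‖ * ‖x‖⁻¹ * c x) • v
          + (α₁ ‖x‖ * ‖x‖⁻¹ * ⟪x, v⟫) • g + α ‖x‖ • B v := by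
  have hcx := hc.hasFDerivAt
  obtain ⟨G, hG, rfl, hB⟩ := hc
  have hN := hasFDerivAt_norm_of_ne_zero hx
  have h1 := hα₁.comp_hasFDerivAt x hN
  have h2 := (hasDerivAt_inv (norm_ne_zero_iff.mpr hx)).comp_hasFDerivAt x hN
  have h3 := hα.self_of_nhds.comp_hasFDerivAt x hN
  have h4 := (((h1.mul h2).mul hcx).smul (hasFDerivAt_id x)).add (h3.smul hB)
  refine ⟨_, ⟨fun z => (α₁ ‖z‖ * ‖z‖⁻¹ * c z) • z + α ‖z‖ • G z, ?_, rfl, h4⟩, fun v => ?_⟩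
  · filter_upwards [hG, continuousAt_id.norm.eventually hα, isOpen_ne.mem_nhds hx]
      with z hz hαz hz0
    have h5 := HasDerivAt.comp_hasFDerivAt z hαz (hasFDerivAt_norm_of_ne_zero hz0)
    refine hasGradientAt_of_hasFDerivAt (h5.mul hz.hasFDerivAt) fun v => ?_
    simp [inner_add_left, inner_smul_left]
    ring
  · simp
    have : ‖x‖ ≠ 0 := norm_ne_zero_iff.mpr hx
    module

/-! ### Functions on the sphere and their extensions constant along rays -/

/-- A function on `ℝ³ ∖ {0}` that is smooth and constant along rays. -/
structure SmoothAngular (F : R3 → ℝ) : Prop where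
  contDiffAt : ∀ x : R3, x ≠ 0 → ContDiffAt ℝ ∞ F x
  map_smul : ∀ t : ℝ, 0 < t → ∀ x : R3, F (t • x) = F x

/-- The Euclidean Hessian as an endomorphism. -/
noncomputable def hessian (F : R3 → ℝ) (x : R3) : R3 →L[ℝ] R3 := fderiv ℝ (gradient F) x

lemma ne_zero_of_mem_S2 (y : S2) : (y : R3) ≠ 0 := ne_zero_of_mem_unit_sphere y

lemma radialExt_of_ne_zero (f : S2 → ℝ) {x : R3} (hx : x ≠ 0) :
    radialExt f x = f ⟨‖x‖⁻¹ • x, inv_norm_smul_mem_S2 hx⟩ := by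
  simp [radialExt, hx]

lemma radialExt_smul (f : S2 → ℝ) {t : ℝ} (ht : 0 < t) (x : R3) :
    radialExt f (t • x) = radialExt f x := by
  rcases eq_or_ne x 0 with rfl | hx
  · simp
  rw [radialExt_of_ne_zero f hx, radialExt_of_ne_zero f (smul_ne_zero ht.ne' hx)]
  congr 2
  rw [norm_smul, Real.norm_of_nonneg ht.le, smul_smul]
  congr 1
  have : ‖x‖ ≠ 0 := norm_ne_zero_iff.mpr hx
  field_simp

lemma radialExt_coe (f : S2 → ℝ) (y : S2) : radialExt f (y : R3) = f y := by
  rw [radialExt_of_ne_zero f (ne_zero_of_mem_S2 y)]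
  congr 1
  ext1
  simp

lemma contDiffAt_normalize {x : R3} (hx : x ≠ 0) :
    ContDiffAt ℝ ∞ (fun z : R3 => ‖z‖⁻¹ • z) x :=
  ((contDiffAt_norm ℝ hx).inv (norm_ne_zero_iff.mpr hx)).smul contDiffAt_id

lemma smoothAngular_radialExt {f : S2 → ℝ} (hf : ContMDiff (𝓡 2) 𝓘(ℝ, ℝ) ∞ f) :
    SmoothAngular (radialExt f) := by
  refine ⟨fun x hx => ?_, fun t ht x => radialExt_smul f ht x⟩
  let U : TopologicalSpace.Opens R3 := ⟨{x | x ≠ 0}, isOpen_ne⟩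
  have h1 : ContMDiff 𝓘(ℝ, R3) 𝓘(ℝ, R3) ∞ (fun z : U => ‖(z : R3)‖⁻¹ • (z : R3)) := fun z =>
    ((contDiffAt_normalize z.2).contMDiffAt (x := (z : R3))).comp z contMDiff_subtype_val.contMDiffAt
  have h2 := h1.codRestrict_sphere (n := 2) fun z => inv_norm_smul_mem_S2 z.2
  have h3 := hf.comp h2
  have h4 := h3.contMDiffAt (x := (⟨x, hx⟩ : U))
  have e : (f ∘ Set.codRestrict (fun z : U => ‖(z : R3)‖⁻¹ • (z : R3)) _
      fun z => inv_norm_smul_mem_S2 z.2) = fun z : U => radialExt f (z : R3) := by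
    funext z
    rw [radialExt_of_ne_zero f z.2]
    rfl
  rw [e] at h4
  exact (contMDiffAt_subtype_iff.mp h4).contDiffAt

/-- Composing with `z ↦ z / |z|` preserves smoothness away from the origin. This gives the
regularity of `φ` and `ψ`, which are restrictions of expressions in the derivatives of `radialExt
f`. -/
lemma smoothAngular_radialExt_restrict {K : R3 → ℝ} (hK : ∀ x : R3, x ≠ 0 → ContDiffAt ℝ ∞ K x) :
    SmoothAngular (radialExt fun y : S2 => K y) := by
  refine ⟨fun x hx => ?_, fun t ht x => radialExt_smul _ ht x⟩
  have hx' : ‖x‖⁻¹ • x ≠ 0 := smul_ne_zero (inv_ne_zero (norm_ne_zero_iff.mpr hx)) hx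
  refine (ContDiffAt.comp (f := fun z : R3 => ‖z‖⁻¹ • z) x (hK _ hx')
    (contDiffAt_normalize hx)).congr_of_eventuallyEq ?_
  filter_upwards [isOpen_ne.mem_nhds hx] with z hz
  exact radialExt_of_ne_zero _ hz

namespace SmoothAngular

variable {F : R3 → ℝ} (hF : SmoothAngular F)
include hF

lemma hasGradientAt {x : R3} (hx : x ≠ 0) : HasGradientAt F (gradient F x) x :=
  ((hF.contDiffAt x hx).differentiableAt (by simp)).hasGradientAt

lemma contDiffAt_gradient {x : R3} (hx : x ≠ 0) : ContDiffAt ℝ ∞ (gradient F) x :=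
  _root_.contDiffAt_gradient (hF.contDiffAt x hx) (by simp)

lemma hasFDerivAt_gradient {x : R3} (hx : x ≠ 0) :
    HasFDerivAt (gradient F) (hessian F x) x :=
  ((hF.contDiffAt_gradient hx).differentiableAt (by simp)).hasFDerivAt

lemma contDiffAt_hessian {x : R3} (hx : x ≠ 0) : ContDiffAt ℝ ∞ (hessian F) x :=
  (hF.contDiffAt_gradient hx).fderiv_right (by simp)

lemma hasJet2 {x : R3} (hx : x ≠ 0) : HasJet2 F x (gradient F x) (hessian F x) :=
  ⟨gradient F, by filter_upwards [isOpen_ne.mem_nhds hx] with z hz using hF.hasGradientAt hz, rfl,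
    hF.hasFDerivAt_gradient hx⟩

lemma gradient_smul {t : ℝ} (ht : 0 < t) (x : R3) : gradient F (t • x) = t⁻¹ • gradient F x := by
  have h1 : fderiv ℝ F x = t • fderiv ℝ F (t • x) := by
    rw [← fderiv_comp_smul (f := F), show (fun z => F (t • z)) = F from funext (hF.map_smul t ht)]
  unfold gradient
  rw [h1, _root_.map_smul, smul_smul, inv_mul_cancel₀ ht.ne', one_smul]

lemma hessian_smul {t : ℝ} (ht : 0 < t) (x : R3) :
    hessian F (t • x) = (t⁻¹ ^ 2) • hessian F x := by
  have h1 : t • fderiv ℝ (gradient F) (t • x) = t⁻¹ • fderiv ℝ (gradient F) x := by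
    rw [← fderiv_comp_smul, show (fun z => gradient F (t • z)) = t⁻¹ • gradient F from
      funext (hF.gradient_smul ht), fderiv_const_smul_field, Pi.smul_apply]
  unfold hessian
  rw [pow_two, mul_smul, ← h1, smul_smul, inv_mul_cancel₀ ht.ne', one_smul]

lemma inner_gradient_self {x : R3} (hx : x ≠ 0) : ⟪gradient F x, x⟫ = 0 := by
  have h1 : HasDerivAt (fun t : ℝ => t • x) x 1 := by
    simpa using (hasDerivAt_id (1 : ℝ)).smul_const x
  have h0 : HasGradientAt F (gradient F x) ((1 : ℝ) • x) := by simpa using hF.hasGradientAt hx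
  have h2 := h0.hasFDerivAt.comp_hasDerivAt (1 : ℝ) h1
  have h3 : HasDerivAt (F ∘ fun t : ℝ => t • x) 0 1 := by
    refine (hasDerivAt_const (1 : ℝ) (F x)).congr_of_eventuallyEq ?_
    filter_upwards [lt_mem_nhds (zero_lt_one (α := ℝ))] with t ht
    exact hF.map_smul t ht x
  simpa using h2.unique h3

/-- Euler's relation for the gradient, which is homogeneous of degree `-1`. -/
lemma hessian_self {x : R3} (hx : x ≠ 0) : hessian F x x = -gradient F x := by
  have h1 : HasDerivAt (fun t : ℝ => t • x) x 1 := by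
    simpa using (hasDerivAt_id (1 : ℝ)).smul_const x
  have h0 : HasFDerivAt (gradient F) (hessian F x) ((1 : ℝ) • x) := by
    simpa using hF.hasFDerivAt_gradient hx
  have h2 := h0.comp_hasDerivAt (1 : ℝ) h1
  have h3 : HasDerivAt (gradient F ∘ fun t : ℝ => t • x) (-gradient F x) 1 := by
    have h4 := (hasDerivAt_inv (one_ne_zero (α := ℝ))).smul_const (gradient F x)
    have h5 : HasDerivAt (fun t : ℝ => t⁻¹ • gradient F x) (-gradient F x) 1 := by
      simpa using h4
    refine h5.congr_of_eventuallyEq ?_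
    filter_upwards [lt_mem_nhds (zero_lt_one (α := ℝ))] with t ht
    exact hF.gradient_smul ht x
  exact h2.unique h3

/-- Obtained by differentiating the identity `⟪∇F, x⟫ = 0`; symmetry of the Hessian is not needed.
-/
lemma inner_hessian_self {x : R3} (hx : x ≠ 0) (v : R3) :
    ⟪hessian F x v, x⟫ = -⟪gradient F x, v⟫ := by
  have h1 := (hF.hasFDerivAt_gradient hx).inner ℝ (hasFDerivAt_id x)
  have h2 : HasFDerivAt (fun z : R3 => ⟪gradient F z, id z⟫) (0 : R3 →L[ℝ] ℝ) x := by
    refine (hasFDerivAt_const (0 : ℝ) x).congr_of_eventuallyEq ?_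
    filter_upwards [isOpen_ne.mem_nhds hx] with z hz
    exact hF.inner_gradient_self hz
  have h3 := DFunLike.congr_fun (h1.unique h2) v
  simp at h3 ⊢
  linarith

lemma continuous_gradient : Continuous fun y : S2 => gradient F (y : R3) :=
  continuous_iff_continuousAt.mpr fun y =>
    ContinuousAt.comp (f := ((↑) : S2 → R3))
      (hF.contDiffAt_gradient (ne_zero_of_mem_S2 y)).continuousAt continuous_subtype_val.continuousAt

lemma continuous_hessian : Continuous fun y : S2 => hessian F (y : R3) :=
  continuous_iff_continuousAt.mpr fun y =>
    ContinuousAt.comp (f := ((↑) : S2 → R3))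
      (hF.contDiffAt_hessian (ne_zero_of_mem_S2 y)).continuousAt continuous_subtype_val.continuousAt

lemma continuous_restrict : Continuous fun y : S2 => F (y : R3) :=
  continuous_iff_continuousAt.mpr fun y =>
    ContinuousAt.comp (f := ((↑) : S2 → R3))
      (hF.contDiffAt _ (ne_zero_of_mem_S2 y)).continuousAt continuous_subtype_val.continuousAt

lemma laplacian_eq {x : R3} (hx : x ≠ 0) : Laplacian.laplacian F x = trace3 (hessian F x) := by
  rw [InnerProductSpace.laplacian_eq_iteratedFDeriv_orthonormalBasis F
    (EuclideanSpace.basisFun (Fin 3) ℝ)]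
  refine Finset.sum_congr rfl fun i _ => ?_
  rw [iteratedFDeriv_two_apply]
  have e : fderiv ℝ F = fun z => InnerProductSpace.toDual ℝ R3 (gradient F z) := by
    funext z; simp [gradient]
  have h1 : HasFDerivAt (fderiv ℝ F) ((innerSL ℝ : R3 →L[ℝ] R3 →L[ℝ] ℝ).comp (hessian F x)) x := by
    rw [e]
    exact (innerSL ℝ : R3 →L[ℝ] R3 →L[ℝ] ℝ).hasFDerivAt.comp x (hF.hasFDerivAt_gradient hx)
  rw [h1.fderiv]
  simp [EuclideanSpace.inner_single_right]

end SmoothAngular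

lemma continuous_trace3 : Continuous trace3 := by
  unfold trace3
  fun_prop

/-! ### Smoothness of `φ` and `ψ`, and the identities that relate them to `f` -/

section PhiPsi

variable {H : ℝ} {f : S2 → ℝ} (hf : SmoothAngular (radialExt f))
include hf

lemma smoothAngular_normSq_sphereGrad :
    SmoothAngular (radialExt fun z => ‖sphereGrad f z‖ ^ 2) :=
  smoothAngular_radialExt_restrict (K := fun x => ‖gradient (radialExt f) x‖ ^ 2)
    fun _ hx => (hf.contDiffAt_gradient hx).norm_sq ℝ

lemma smoothAngular_phi : SmoothAngular (radialExt (phi H f)) :=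
  smoothAngular_radialExt_restrict
    (K := fun x => (1 / 2) * ((H ^ 2)⁻¹ + ‖gradient (radialExt f) x‖ ^ 2))
    fun _ hx => contDiffAt_const.mul
      (contDiffAt_const.add ((hf.contDiffAt_gradient hx).norm_sq ℝ))

lemma contDiffAt_laplacian {x : R3} (hx : x ≠ 0) :
    ContDiffAt ℝ ∞ (Laplacian.laplacian (radialExt f)) x := by
  have h : ContDiffAt ℝ ∞ (fun z => trace3 (hessian (radialExt f) z)) x := by
    have := hf.contDiffAt_hessian hx
    unfold trace3
    refine ContDiffAt.sum fun i _ => ?_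
    have h1 : ContDiffAt ℝ ∞ (fun z => hessian (radialExt f) z (EuclideanSpace.single i 1)) x :=
      this.clm_apply contDiffAt_const
    exact (EuclideanSpace.proj i : R3 →L[ℝ] ℝ).contDiff.contDiffAt.comp x h1
  refine h.congr_of_eventuallyEq ?_
  filter_upwards [isOpen_ne.mem_nhds hx] with z hz using hf.laplacian_eq hz

lemma smoothAngular_psi : SmoothAngular (radialExt (psi H f)) :=
  smoothAngular_radialExt_restrict
    (K := fun x => (1 / 2) * ((H ^ 2)⁻¹ * Laplacian.laplacian (radialExt f) x +
      inner ℝ (gradient (radialExt fun z => ‖sphereGrad f z‖ ^ 2) x) (gradient (radialExt f) x)))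
    fun _ hx => contDiffAt_const.mul ((contDiffAt_const.mul (contDiffAt_laplacian hf hx)).add
      (((smoothAngular_normSq_sphereGrad hf).contDiffAt_gradient hx).inner ℝ
        (hf.contDiffAt_gradient hx)))

/-- Away from the origin the extension of `|∇f|²` is twice that of `φ`, minus a constant. -/
lemma gradient_normSq_sphereGrad (y : S2) :
    gradient (radialExt fun z => ‖sphereGrad f z‖ ^ 2) (y : R3)
      = (2 : ℝ) • gradient (radialExt (phi H f)) (y : R3) := by
  have h1 := ((smoothAngular_phi (H := H) hf).hasGradientAt (ne_zero_of_mem_S2 y)).hasFDerivAt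
  have h2 := ((h1.const_mul 2).sub_const ((H ^ 2)⁻¹))
  refine HasGradientAt.gradient (hasGradientAt_of_hasFDerivAt (h2.congr_of_eventuallyEq ?_)
    fun v => by simp [inner_smul_left])
  filter_upwards [isOpen_ne.mem_nhds (ne_zero_of_mem_S2 y)] with z hz
  rw [radialExt_of_ne_zero _ hz, radialExt_of_ne_zero _ hz, phi]
  ring

lemma psi_eq (y : S2) :
    psi H f y = (1 / 2) * (H ^ 2)⁻¹ * trace3 (hessian (radialExt f) y)
      + ⟪gradient (radialExt f) (y : R3), gradient (radialExt (phi H f)) (y : R3)⟫ := by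
  have h1 : sphereGrad (fun z => ‖sphereGrad f z‖ ^ 2) y
      = (2 : ℝ) • gradient (radialExt (phi H f)) (y : R3) := gradient_normSq_sphereGrad hf y
  rw [psi, h1, sphereLaplacian, hf.laplacian_eq (ne_zero_of_mem_S2 y), inner_smul_left,
    real_inner_comm]
  simp [sphereGrad]
  ring

lemma inner_hessian_gradient (y : S2) :
    ⟪hessian (radialExt f) y (gradient (radialExt f) y), gradient (radialExt f) (y : R3)⟫
      = ⟪gradient (radialExt f) (y : R3), gradient (radialExt (phi H f)) (y : R3)⟫ := by
  have hy := ne_zero_of_mem_S2 y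
  have h1 := ((smoothAngular_phi (H := H) hf).hasGradientAt hy).hasFDerivAt
  have h2 := (hf.hasFDerivAt_gradient hy).norm_sq
  have h3 := (((hasStrictFDerivAt_norm_sq (y : R3)).hasFDerivAt.mul h2).const_add
    ((H ^ 2)⁻¹)).const_mul (1 / 2)
  -- The extension of `φ` is homogeneous of degree `0` and `|∇F|²` of degree `-2`, whence the factor
  -- `|z|²`. Its derivative vanishes in the tangential direction `∇F`, so only the Hessian term
  -- survives below.
  have e : radialExt (phi H f) =ᶠ[𝓝 (y : R3)] fun z =>
      1 / 2 * ((H ^ 2)⁻¹ + ‖z‖ ^ 2 * ‖gradient (radialExt f) z‖ ^ 2) := by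
    filter_upwards [isOpen_ne.mem_nhds hy] with z hz
    have hz' : 0 < ‖z‖ := norm_pos_iff.mpr hz
    rw [radialExt_of_ne_zero _ hz, phi, sphereGrad, hf.gradient_smul (inv_pos.mpr hz'), inv_inv,
      norm_smul, norm_norm, mul_pow]
  have h4 := DFunLike.congr_fun (h1.unique (h3.congr_of_eventuallyEq e))
    (gradient (radialExt f) (y : R3))
  have h5 := hf.inner_gradient_self hy
  rw [real_inner_comm] at h5
  have hn : ‖(y : R3)‖ = 1 := by simp
  simp [h5, hn] at h4
  rw [h1.fderiv, (hf.hasGradientAt hy).hasFDerivAt.fderiv, InnerProductSpace.toDual_apply_apply,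
    InnerProductSpace.toDual_apply_apply] at h4
  rw [real_inner_comm, ← h4, real_inner_comm]

end PhiPsi

/-! ### The mean curvature operator of an asymptotic expansion -/

lemma trace3_apply_eq (B : R3 →L[ℝ] R3) :
    trace3 B = ∑ i : Fin 3, ⟪EuclideanSpace.single i (1 : ℝ), B (EuclideanSpace.single i 1)⟫ := by
  simp [trace3, EuclideanSpace.inner_single_left]

lemma sum_inner_single_mul (a b : R3) :
    ∑ i : Fin 3, ⟪a, EuclideanSpace.single i (1 : ℝ)⟫ * ⟪EuclideanSpace.single i (1 : ℝ), b⟫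
      = ⟪a, b⟫ := by
  simp [PiLp.inner_apply, mul_comm]

/-- The mean curvature operator in terms of radial and angular derivatives. -/
lemma mcOperator_radial_angular {m r ρ κ q : ℝ} {y τ μ : R3} {M B : R3 →L[ℝ] R3} (hm : 0 < m)
    (hr : 2 * m < r) (hy : ‖y‖ = 1) (hτ : ⟪y, τ⟫ = 0) (hμ : ⟪y, μ⟫ = 0) (hM : M y = -τ)
    (hM' : ∀ v, ⟪M v, y⟫ = -⟪τ, v⟫) (hκ : κ = (1 - 2 * m * r⁻¹) * ρ)
    (hB : ∀ v, B v = (q * ⟪y, v⟫ + ⟪μ, v⟫ - ρ * r⁻¹ * ⟪y, v⟫) • y + (ρ * r⁻¹) • v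
      + ⟪y, v⟫ • μ + (r⁻¹ ^ 2) • M v) :
    lapseSq m (r • y) (ρ • y + r⁻¹ • τ)
        = (1 - 2 * m * r⁻¹)⁻¹ - κ * ρ - r⁻¹ ^ 2 * ‖τ‖ ^ 2 ∧
      mcPrincipal m (r • y) (ρ • y + r⁻¹ • τ) B + mcLower m (r • y) (ρ • y + r⁻¹ • τ)
        = lapseSq m (r • y) (ρ • y + r⁻¹ • τ) * (q * (1 - 2 * m * r⁻¹) + 2 * ρ * r⁻¹
            + r⁻¹ ^ 2 * trace3 M - 2 * m * ρ * r⁻¹ ^ 2)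
          + κ ^ 2 * q + 2 * κ * r⁻¹ * (⟪μ, τ⟫ - r⁻¹ ^ 2 * ‖τ‖ ^ 2)
          + r⁻¹ ^ 2 * (ρ * r⁻¹ * ‖τ‖ ^ 2 + r⁻¹ ^ 2 * ⟪M τ, τ⟫)
          + m * r⁻¹ ^ 2 * ((1 - 2 * m * r⁻¹)⁻¹ * ρ + (1 - 2 * m * r⁻¹) * ρ ^ 3
            - 2 * ρ * r⁻¹ ^ 2 * ‖τ‖ ^ 2) := by
  have r0 : 0 < r := by linarith
  have hτ' : ⟪τ, y⟫ = 0 := by rw [real_inner_comm, hτ]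
  have hμ' : ⟪μ, y⟫ = 0 := by rw [real_inner_comm, hμ]
  have hyy : ⟪y, y⟫ = 1 := by rw [real_inner_self_eq_norm_sq, hy]; norm_num
  have hx : ‖r • y‖ = r := by rw [norm_smul, hy, Real.norm_of_nonneg r0.le, mul_one]
  obtain ⟨g, hg⟩ : ∃ g, g = ρ • y + r⁻¹ • τ := ⟨_, rfl⟩
  have hs : ⟪r • y, g⟫ = r * ρ := by
    rw [hg]; simp only [inner_smul_left, inner_add_right, inner_smul_right, hyy, hτ]; simp [mul_comm]
  have hg2 : ‖g‖ ^ 2 = ρ ^ 2 + r⁻¹ ^ 2 * ‖τ‖ ^ 2 := by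
    rw [← real_inner_self_eq_norm_sq, hg]
    simp only [inner_add_left, inner_add_right, inner_smul_left, inner_smul_right, hyy, hτ, hτ',
      real_inner_self_eq_norm_sq τ]
    simp; ring
  -- Raising the index multiplies the radial component by `h` and leaves the angular part unchanged;
  -- hence `κ = h ρ`.
  have hV : raisedGrad m (r • y) g = κ • y + r⁻¹ • τ := by
    rw [raisedGrad, hs, hx, hg, hκ]
    match_scalars
    · field_simp
    · simp
  have hBy : B y = q • y + μ - (r⁻¹ ^ 2) • τ := by
    rw [hB, hyy, hμ', hM]; module
  have hBτ : B τ = ⟪μ, τ⟫ • y + (ρ * r⁻¹) • τ + (r⁻¹ ^ 2) • M τ := by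
    rw [hB, hτ]; module
  have c1 : ⟪B y, y⟫ = q := by
    rw [hBy]; simp [inner_add_left, inner_sub_left, inner_smul_left, hμ', hτ', hy]
  have c2 : ⟪B y, τ⟫ = ⟪μ, τ⟫ - r⁻¹ ^ 2 * ‖τ‖ ^ 2 := by
    rw [hBy]; simp [inner_add_left, inner_sub_left, inner_smul_left, hτ]
  have c3 : ⟪B τ, y⟫ = ⟪μ, τ⟫ - r⁻¹ ^ 2 * ‖τ‖ ^ 2 := by
    rw [hBτ]; simp [inner_add_left, inner_smul_left, hτ', hM', hy]; ring
  have c4 : ⟪B τ, τ⟫ = ρ * r⁻¹ * ‖τ‖ ^ 2 + r⁻¹ ^ 2 * ⟪M τ, τ⟫ := by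
    rw [hBτ]; simp [inner_add_left, inner_smul_left, hτ]
  have hBx : ⟪B (r • y), r • y⟫ = r ^ 2 * q := by
    rw [map_smul, inner_smul_left, inner_smul_right, c1]; simp; ring
  have hBV : ⟪B (κ • y + r⁻¹ • τ), κ • y + r⁻¹ • τ⟫ = κ ^ 2 * q
      + 2 * κ * r⁻¹ * (⟪μ, τ⟫ - r⁻¹ ^ 2 * ‖τ‖ ^ 2)
      + r⁻¹ ^ 2 * (ρ * r⁻¹ * ‖τ‖ ^ 2 + r⁻¹ ^ 2 * ⟪M τ, τ⟫) := by
    simp only [map_add, map_smul, inner_add_left, inner_add_right, inner_smul_left,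
      inner_smul_right, c1, c2, c3, c4]
    simp; ring
  have htr : trace3 B = q + 2 * ρ * r⁻¹ + r⁻¹ ^ 2 * trace3 M := by
    have e1 := sum_inner_single_mul y y
    have e2 := sum_inner_single_mul μ y
    have e3 := sum_inner_single_mul y μ
    rw [hyy] at e1
    rw [hμ'] at e2
    rw [hμ] at e3
    have e4 : ∀ i : Fin 3, ⟪EuclideanSpace.single i (1 : ℝ), EuclideanSpace.single i (1 : ℝ)⟫
        = (1 : ℝ) := fun i => by simp
    rw [trace3_apply_eq, trace3_apply_eq]
    simp only [hB, inner_add_right, inner_smul_right, Fin.sum_univ_three, e4] at e1 e2 e3 ⊢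
    linear_combination (q - ρ * r⁻¹) * e1 + e2 + e3
  have hw : lapseSq m (r • y) g = (1 - 2 * m * r⁻¹)⁻¹ - κ * ρ - r⁻¹ ^ 2 * ‖τ‖ ^ 2 := by
    rw [lapseSq, hx, hs, hg2, hκ, div_eq_mul_inv (2 * m) r]
    generalize (1 - 2 * m * r⁻¹)⁻¹ = i
    field_simp
    ring
  rw [← hg]
  refine ⟨hw, ?_⟩
  rw [mcPrincipal, mcLower, hV, hBV, hBx, htr, hx, hs, hg2]
  obtain ⟨w, hw'⟩ : ∃ w, w = lapseSq m (r • y) g := ⟨_, rfl⟩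
  rw [← hw', div_eq_mul_inv (2 * m) r]
  generalize (1 - 2 * m * r⁻¹)⁻¹ = i
  field_simp
  ring

/-- The normalized value of `lapseSq` along an asymptotic expansion, at `ε = 1/r`. -/
noncomputable def expansionLapse (m A φ ψ T ε : ℝ) : ℝ :=
  2 * φ + 2 * ψ * ε + 6 * A * ε ^ 2
    - (1 - 2 * m * ε) * ε ^ 2 * (φ + ψ * ε + 3 * A * ε ^ 2) ^ 2 - T

/-- The normalized value of the mean curvature operator along an asymptotic expansion, at
`ε = 1/r`. -/
noncomputable def expansionOperator (m A φ ψ T tr c b ε : ℝ) : ℝ :=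
  let P := φ + ψ * ε + 3 * A * ε ^ 2
  let P' := 2 * φ + 3 * ψ * ε + 12 * A * ε ^ 2
  let κ := 1 - (1 - 2 * m * ε) * ε ^ 2 * P
  expansionLapse m A φ ψ T ε *
      (2 + ε ^ 2 * ((1 - 2 * m * ε) * P' - (2 - 2 * m * ε) * P) + ε * tr)
    + m * κ * ε ^ 3 * P ^ 2 + κ ^ 2 * P' - 2 * κ * c + ε * b + κ * T

/-- The derivative of `r_*` is `h⁻¹`, so `κ = 1 - h ε² P` and `h⁻¹ - κ ρ = h⁻¹ (1 - κ)(1 + κ) = ε² P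
(1 + κ)`. Every factor `h⁻¹` cancels, leaving powers of `ε` times quantities polynomial in all their
arguments, hence meaningful at `ε = 0`. -/
lemma mcOperator_eq_expansion {m A φ ψ T tr b c ε ρ κ q w N : ℝ} (hε : 1 - 2 * m * ε ≠ 0)
    (hρ : ρ = (1 - 2 * m * ε)⁻¹ - ε ^ 2 * (φ + ψ * ε + 3 * A * ε ^ 2))
    (hκ : κ = (1 - 2 * m * ε) * ρ)
    (hq : q = -2 * m * ε ^ 2 * (1 - 2 * m * ε)⁻¹ ^ 2
      + ε ^ 3 * (2 * φ + 3 * ψ * ε + 12 * A * ε ^ 2))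
    (hN : N = -ε ^ 2 * c)
    (hw : w = (1 - 2 * m * ε)⁻¹ - κ * ρ - ε ^ 2 * T) :
    w = ε ^ 2 * expansionLapse m A φ ψ T ε ∧
    w * (q * (1 - 2 * m * ε) + 2 * ρ * ε + ε ^ 2 * tr - 2 * m * ρ * ε ^ 2)
          + κ ^ 2 * q + 2 * κ * ε * N + ε ^ 2 * (ρ * ε * T + ε ^ 2 * b)
          + m * ε ^ 2 * ((1 - 2 * m * ε)⁻¹ * ρ + (1 - 2 * m * ε) * ρ ^ 3 - 2 * ρ * ε ^ 2 * T)
      = ε ^ 3 * expansionOperator m A φ ψ T tr c b ε := by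
  obtain ⟨P, hP⟩ : ∃ P, P = φ + ψ * ε + 3 * A * ε ^ 2 := ⟨_, rfl⟩
  obtain ⟨P', hP'⟩ : ∃ P', P' = 2 * φ + 3 * ψ * ε + 12 * A * ε ^ 2 := ⟨_, rfl⟩
  obtain ⟨h, hh⟩ : ∃ h, h = 1 - 2 * m * ε := ⟨_, rfl⟩
  obtain ⟨S, hS⟩ : ∃ S, S = expansionLapse m A φ ψ T ε := ⟨_, rfl⟩
  have hκ' : κ = 1 - h * ε ^ 2 * P := by
    rw [hκ, hρ, ← hh, ← hP]
    rw [← hh] at hε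
    linear_combination mul_inv_cancel₀ hε
  have hwS : w = ε ^ 2 * S := by
    rw [hw, hS, hκ', hρ, expansionLapse, ← hh, ← hP]
    rw [← hh] at hε
    field_simp
    rw [hP]
    ring
  rw [expansionOperator, ← hP, ← hP', ← hh, ← hS, ← hκ']
  refine ⟨hwS, ?_⟩
  rw [hwS, hq, hN, ← hh, ← hP']
  have hρ' : ρ = h⁻¹ * κ := by rw [hκ, ← hh]; rw [← hh] at hε; field_simp
  rw [← hh] at hε
  rw [hρ']
  field_simp
  rw [hκ', hh]
  ring

/-! ### The barriers -/

/-- The barrier `r_* + F + Φ/r + Ψ/(2r²) + A/r³`. -/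
noncomputable def barrier (m A : ℝ) (F Φ Ψ : R3 → ℝ) (x : R3) : ℝ :=
  rStar m ‖x‖ + A * (‖x‖ ^ 3)⁻¹ + F x + ‖x‖⁻¹ * Φ x + (1 / 2) * (‖x‖ ^ 2)⁻¹ * Ψ x

lemma HasJet2.congr {u v : R3 → ℝ} {x g g' : R3} {B : R3 →L[ℝ] R3} (hu : HasJet2 u x g B)
    (h : ∀ z, v z = u z) (hg : g' = g) : HasJet2 v x g' B := by
  rw [show v = u from funext h, hg]
  exact hu

lemma hasJet2_const (c : ℝ) (x : R3) : HasJet2 (fun _ => c) x 0 0 :=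
  ⟨fun _ => 0, Filter.Eventually.of_forall fun z => hasGradientAt_const z c, rfl,
    hasFDerivAt_const _ _⟩

lemma hasDerivAt_inv_pow (k : ℕ) {t : ℝ} (ht : t ≠ 0) :
    HasDerivAt (fun t : ℝ => (t ^ k)⁻¹) (-k * (t ^ (k + 1))⁻¹) t := by
  refine ((hasDerivAt_pow k t).fun_inv (pow_ne_zero k ht)).congr_deriv ?_
  rcases k with _ | k
  · simp
  · simp only [Nat.add_sub_cancel]
    field_simp
    ring

lemma hasDerivAt_rStar {m t : ℝ} (hm : 0 < m) (ht : 2 * m < t) :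
    HasDerivAt (rStar m) (1 - 2 * m * t⁻¹)⁻¹ t := by
  have t0 : t ≠ 0 := by linarith
  have h1 : t / (2 * m) - 1 ≠ 0 := by
    rw [div_sub_one (by positivity)]
    exact div_ne_zero (by linarith) (by positivity)
  have h2 : t - 2 * m ≠ 0 := by linarith
  have h3 : 1 - 2 * m * t⁻¹ ≠ 0 := by
    rw [← div_eq_mul_inv, one_sub_div t0]; exact div_ne_zero h2 t0
  have h := (hasDerivAt_id t).add
    (((((hasDerivAt_id t).div_const (2 * m)).sub_const 1).log h1).const_mul (2 * m))
  refine h.congr_deriv ?_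
  simp only [id]
  rw [div_sub_one (by positivity), ← div_eq_mul_inv, one_sub_div t0]
  field_simp
  ring

lemma hasDerivAt_inv_one_sub {m t : ℝ} (hm : 0 < m) (ht : 2 * m < t) :
    HasDerivAt (fun t : ℝ => (1 - 2 * m * t⁻¹)⁻¹)
      (-2 * m * t⁻¹ ^ 2 * (1 - 2 * m * t⁻¹)⁻¹ ^ 2) t := by
  have t0 : t ≠ 0 := by linarith
  have h2 : t - 2 * m ≠ 0 := by linarith
  have h3 : 1 - 2 * m * t⁻¹ ≠ 0 := by
    rw [← div_eq_mul_inv, one_sub_div t0]; exact div_ne_zero h2 t0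
  refine ((((hasDerivAt_inv t0).const_mul (2 * m)).const_sub 1).fun_inv h3).congr_deriv ?_
  field_simp

lemma hasJet2_barrier {m A r : ℝ} {F Φ Ψ : R3 → ℝ} (hF : SmoothAngular F) (hΦ : SmoothAngular Φ)
    (hΨ : SmoothAngular Ψ) (hm : 0 < m) (hr : 2 * m < r) (y : S2) :
    ∃ B : R3 →L[ℝ] R3, HasJet2 (barrier m A F Φ Ψ) (r • (y : R3))
      (((1 - 2 * m * r⁻¹)⁻¹ - r⁻¹ ^ 2 * (Φ y + Ψ y * r⁻¹ + 3 * A * r⁻¹ ^ 2)) • (y : R3)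
        + r⁻¹ • (gradient F y + r⁻¹ • gradient Φ y + (1 / 2 * r⁻¹ ^ 2) • gradient Ψ y)) B ∧
      ∀ v, B v = ((-2 * m * r⁻¹ ^ 2 * (1 - 2 * m * r⁻¹)⁻¹ ^ 2
            + r⁻¹ ^ 3 * (2 * Φ y + 3 * Ψ y * r⁻¹ + 12 * A * r⁻¹ ^ 2)) * ⟪(y : R3), v⟫
          + ⟪-(r⁻¹ ^ 3) • gradient Φ y - (r⁻¹ ^ 4) • gradient Ψ y, v⟫
          - ((1 - 2 * m * r⁻¹)⁻¹ - r⁻¹ ^ 2 * (Φ y + Ψ y * r⁻¹ + 3 * A * r⁻¹ ^ 2)) * r⁻¹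
            * ⟪(y : R3), v⟫) • (y : R3)
        + (((1 - 2 * m * r⁻¹)⁻¹ - r⁻¹ ^ 2 * (Φ y + Ψ y * r⁻¹ + 3 * A * r⁻¹ ^ 2)) * r⁻¹) • v
        + ⟪(y : R3), v⟫ • (-(r⁻¹ ^ 3) • gradient Φ y - (r⁻¹ ^ 4) • gradient Ψ y)
        + (r⁻¹ ^ 2) • (hessian F y + r⁻¹ • hessian Φ y + (1 / 2 * r⁻¹ ^ 2) • hessian Ψ y) v := by
  have r0 : 0 < r := by linarith
  have hx : ‖r • (y : R3)‖ = r := by simp [norm_smul, abs_of_pos r0]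
  have hx0 : r • (y : R3) ≠ 0 := smul_ne_zero r0.ne' (ne_zero_of_mem_S2 y)
  have ev : ∀ᶠ t in 𝓝 ‖r • (y : R3)‖, 2 * m < t := by rw [hx]; exact lt_mem_nhds hr
  have jF := hF.hasJet2 hx0
  -- The purely radial part is treated as a radial function times the angular function `1`; the
  -- other products are `r⁻¹ Φ` and `½ r⁻² Ψ`.
  obtain ⟨B₀, j₀, b₀⟩ := HasJet2.radial_mul (α := fun t => rStar m t + A * (t ^ 3)⁻¹)
    (α₁ := fun t => (1 - 2 * m * t⁻¹)⁻¹ + A * (-(3 : ℕ) * (t ^ 4)⁻¹)) hx0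
    (by
      filter_upwards [ev] with t ht
      exact (hasDerivAt_rStar hm ht).fun_add
        ((hasDerivAt_inv_pow 3 (by linarith)).const_mul A))
    (by
      rw [hx]
      exact (hasDerivAt_inv_one_sub hm hr).fun_add
        (((hasDerivAt_inv_pow 4 r0.ne').const_mul _).const_mul A))
    (hasJet2_const 1 _)
  obtain ⟨B₁, j₁, b₁⟩ := HasJet2.radial_mul (α := fun t => (t ^ 1)⁻¹)
    (α₁ := fun t => -(1 : ℕ) * (t ^ 2)⁻¹) hx0
    (by
      filter_upwards [ev] with t ht
      exact hasDerivAt_inv_pow 1 (by linarith))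
    (by
      rw [hx]
      exact (hasDerivAt_inv_pow 2 r0.ne').const_mul _)
    (hΦ.hasJet2 hx0)
  obtain ⟨B₂, j₂, b₂⟩ := HasJet2.radial_mul (α := fun t => 1 / 2 * (t ^ 2)⁻¹)
    (α₁ := fun t => 1 / 2 * (-(2 : ℕ) * (t ^ 3)⁻¹)) hx0
    (by
      filter_upwards [ev] with t ht
      exact (hasDerivAt_inv_pow 2 (by linarith)).const_mul _)
    (by
      rw [hx]
      exact ((hasDerivAt_inv_pow 3 r0.ne').const_mul _).const_mul _)
    (hΨ.hasJet2 hx0)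
  refine ⟨_, (((j₀.add jF).add j₁).add j₂).congr (fun z => ?_) ?_, fun v => ?_⟩
  · simp [barrier]
  · rw [hx, hF.gradient_smul r0, hΦ.gradient_smul r0, hΨ.gradient_smul r0, hΦ.map_smul r r0,
      hΨ.map_smul r r0]
    generalize (1 - 2 * m * r⁻¹)⁻¹ = i
    match_scalars
    all_goals field_simp
    all_goals ring
  · simp only [add_apply, b₀, b₁, b₂]
    rw [hx, hF.hessian_smul r0, hΦ.hessian_smul r0, hΨ.hessian_smul r0, hΦ.gradient_smul r0,
      hΨ.gradient_smul r0, hΦ.map_smul r r0, hΨ.map_smul r r0]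
    simp only [inner_sub_left, inner_smul_left, smul_apply, inner_zero_left]
    generalize (1 - 2 * m * r⁻¹)⁻¹ = i
    generalize ⟪(y : R3), v⟫ = a₁
    generalize ⟪gradient Φ (y : R3), v⟫ = a₂
    generalize ⟪gradient Ψ (y : R3), v⟫ = a₃
    simp
    match_scalars <;> field_simp <;> ring

/-- The angular gradient of an asymptotic expansion. -/
noncomputable def expansionGrad (F Φ Ψ : R3 → ℝ) (ε : ℝ) (y : S2) : R3 :=
  gradient F y + ε • gradient Φ y + (1 / 2 * ε ^ 2) • gradient Ψ y

/-- The angular Hessian of an asymptotic expansion. -/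
noncomputable def expansionHess (F Φ Ψ : R3 → ℝ) (ε : ℝ) (y : S2) : R3 →L[ℝ] R3 :=
  hessian F y + ε • hessian Φ y + (1 / 2 * ε ^ 2) • hessian Ψ y

/-- `expansionLapse` of the barrier. -/
noncomputable def barrierLapse (m A : ℝ) (F Φ Ψ : R3 → ℝ) (ε : ℝ) (y : S2) : ℝ :=
  expansionLapse m A (Φ y) (Ψ y) (‖expansionGrad F Φ Ψ ε y‖ ^ 2) ε

/-- `expansionOperator` of the barrier. -/
noncomputable def barrierOperator (m A : ℝ) (F Φ Ψ : R3 → ℝ) (ε : ℝ) (y : S2) : ℝ :=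
  expansionOperator m A (Φ y) (Ψ y) (‖expansionGrad F Φ Ψ ε y‖ ^ 2)
    (trace3 (expansionHess F Φ Ψ ε y))
    ⟪gradient F y + (2 * ε) • gradient Φ y + (3 / 2 * ε ^ 2) • gradient Ψ y,
      expansionGrad F Φ Ψ ε y⟫
    ⟪expansionHess F Φ Ψ ε y (expansionGrad F Φ Ψ ε y), expansionGrad F Φ Ψ ε y⟫ ε

lemma mcOperator_barrier {m A r : ℝ} {F Φ Ψ : R3 → ℝ} (hF : SmoothAngular F)
    (hΦ : SmoothAngular Φ) (hΨ : SmoothAngular Ψ) (hm : 0 < m) (hr : 2 * m < r) (y : S2) :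
    ∃ g : R3, ∃ B : R3 →L[ℝ] R3, HasJet2 (barrier m A F Φ Ψ) (r • (y : R3)) g B ∧
      lapseSq m (r • (y : R3)) g = r⁻¹ ^ 2 * barrierLapse m A F Φ Ψ r⁻¹ y ∧
      mcPrincipal m (r • (y : R3)) g B + mcLower m (r • (y : R3)) g
        = r⁻¹ ^ 3 * barrierOperator m A F Φ Ψ r⁻¹ y := by
  have r0 : 0 < r := by linarith
  have hy0 := ne_zero_of_mem_S2 y
  have hh : 1 - 2 * m * r⁻¹ ≠ 0 := by
    rw [← div_eq_mul_inv, one_sub_div r0.ne']; exact div_ne_zero (by linarith) r0.ne'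
  obtain ⟨B, hJ, hB⟩ := hasJet2_barrier (A := A) hF hΦ hΨ hm hr y
  have o1 := hF.inner_gradient_self hy0
  have o2 := hΦ.inner_gradient_self hy0
  have o3 := hΨ.inner_gradient_self hy0
  rw [real_inner_comm] at o1 o2 o3
  have key := mcOperator_radial_angular (m := m) (r := r) (y := (y : R3))
    (τ := expansionGrad F Φ Ψ r⁻¹ y) (M := expansionHess F Φ Ψ r⁻¹ y) (B := B) hm hr (by simp)
    (by simp only [expansionGrad, inner_add_right, inner_smul_right, o1, o2, o3]; simp)
    (by simp only [inner_sub_right, inner_smul_right, o2, o3]; simp)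
    (by
      simp only [expansionHess, expansionGrad, add_apply, smul_apply, hF.hessian_self hy0,
        hΦ.hessian_self hy0, hΨ.hessian_self hy0]
      module)
    (fun v => by
      simp only [expansionHess, expansionGrad, add_apply, smul_apply, inner_add_left,
        inner_smul_left, hF.inner_hessian_self hy0, hΦ.inner_hessian_self hy0,
        hΨ.inner_hessian_self hy0]
      ring)
    rfl hB
  have key2 := mcOperator_eq_expansion (b := ⟪expansionHess F Φ Ψ r⁻¹ y
      (expansionGrad F Φ Ψ r⁻¹ y), expansionGrad F Φ Ψ r⁻¹ y⟫)
    (tr := trace3 (expansionHess F Φ Ψ r⁻¹ y)) (c := ⟪gradient F y + (2 * r⁻¹) • gradient Φ y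
      + (3 / 2 * r⁻¹ ^ 2) • gradient Ψ y, expansionGrad F Φ Ψ r⁻¹ y⟫)
    (N := ⟪-(r⁻¹ ^ 3) • gradient Φ y - (r⁻¹ ^ 4) • gradient Ψ y, expansionGrad F Φ Ψ r⁻¹ y⟫
      - r⁻¹ ^ 2 * ‖expansionGrad F Φ Ψ r⁻¹ y‖ ^ 2) hh rfl rfl rfl
    (by
      -- Adding the mixed derivatives `ε³ ∇Φ + ε⁴ ∇Ψ` to `ε²` times the angular gradient produces
      -- the weights `2 ε` and `3/2 ε²` in `c`.
      rw [← real_inner_self_eq_norm_sq]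
      nth_rewrite 2 [expansionGrad]
      simp only [inner_sub_left, inner_add_left, inner_smul_left]
      simp
      ring) key.1
  exact ⟨_, B, hJ, key2.1, key.2.trans key2.2⟩

/-! ### Expansion to first order in `ε`, with explicit remainders -/

/-- The remainder of second order of `barrierLapse`. -/
noncomputable def lapseRemainder (m A φ ψ f₃ g₁ g₂ g₃ ε : ℝ) : ℝ :=
  6 * A - (1 - 2 * m * ε) * (φ + ψ * ε + 3 * A * ε ^ 2) ^ 2 - (g₁ + f₃) - ε * g₂
    - 1 / 4 * ε ^ 2 * g₃

/-- The remainder of second order of `barrierOperator`. -/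
noncomputable def operatorRemainder (m A k φ ψ f₁ f₂ f₃ g₁ g₂ g₃ l₀ l₁ b₁ ε : ℝ) : ℝ :=
  let P := φ + ψ * ε + 3 * A * ε ^ 2
  let P' := 2 * φ + 3 * ψ * ε + 12 * A * ε ^ 2
  let h := 1 - 2 * m * ε
  let κ := 1 - h * ε ^ 2 * P
  let S₂ := lapseRemainder m A φ ψ f₃ g₁ g₂ g₃ ε
  let X := h * P' - (2 - 2 * m * ε) * P + l₁
  let Y := -f₁ - 4 * ε * f₂ - ε ^ 2 * (3 * f₃ + 3 * g₁) - 4 * ε ^ 3 * g₂ - 5 / 4 * ε ^ 4 * g₃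
  2 * S₂ + k * l₀ * l₀ + ε * S₂ * l₀ + (k * (1 + l₀ * ε) + ε ^ 2 * S₂) * X + m * κ * ε * P ^ 2
    + 12 * A - h * P * (1 + κ) * P' - (3 * f₃ + 3 * g₁) - 4 * ε * g₂ - 5 / 4 * ε ^ 2 * g₃
    - h * P * Y + b₁

/-- The letters `f₁, f₂, f₃` stand for the products of `∇F` with `∇F, ∇Φ, ∇Ψ`, the letters `g₁, g₂,
g₃` for `|∇Φ|²`, `⟪∇Φ, ∇Ψ⟫`, `|∇Ψ|²`, and `l₀` for the Laplacian of `f`. The hypotheses `h₁` and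
`h₂` are the defining relations of `φ` and `ψ`, with `k = H₀⁻²`. -/
lemma expansionLapse_eq {m A k φ ψ f₁ f₂ f₃ g₁ g₂ g₃ l₀ T ε : ℝ} (h₁ : 2 * φ - f₁ = k)
    (h₂ : ψ = 1 / 2 * k * l₀ + f₂)
    (hT : T = f₁ + 2 * ε * f₂ + ε ^ 2 * (g₁ + f₃) + ε ^ 3 * g₂ + 1 / 4 * ε ^ 4 * g₃) :
    expansionLapse m A φ ψ T ε
      = k * (1 + l₀ * ε) + ε ^ 2 * lapseRemainder m A φ ψ f₃ g₁ g₂ g₃ ε := by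
  rw [expansionLapse, lapseRemainder, hT]
  linear_combination h₁ + 2 * ε * h₂

lemma expansionOperator_eq {m A k φ ψ f₁ f₂ f₃ g₁ g₂ g₃ l₀ l₁ b₁ T tr c b ε : ℝ}
    (h₁ : 2 * φ - f₁ = k) (h₂ : ψ = 1 / 2 * k * l₀ + f₂)
    (hT : T = f₁ + 2 * ε * f₂ + ε ^ 2 * (g₁ + f₃) + ε ^ 3 * g₂ + 1 / 4 * ε ^ 4 * g₃)
    (hc : c = f₁ + 3 * ε * f₂ + ε ^ 2 * (2 * f₃ + 2 * g₁) + 5 / 2 * ε ^ 3 * g₂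
      + 3 / 4 * ε ^ 4 * g₃) (htr : tr = l₀ + ε * l₁) (hb : b = f₂ + ε * b₁) :
    expansionOperator m A φ ψ T tr c b ε
      = 3 * k * (1 + 3 / 2 * l₀ * ε)
        + ε ^ 2 * operatorRemainder m A k φ ψ f₁ f₂ f₃ g₁ g₂ g₃ l₀ l₁ b₁ ε := by
  rw [expansionOperator, expansionLapse_eq (A := A) (m := m) h₁ h₂ hT, operatorRemainder, hT, hc,
    htr, hb]
  obtain ⟨S₂, hS₂⟩ : ∃ S, S = lapseRemainder m A φ ψ f₃ g₁ g₂ g₃ ε := ⟨_, rfl⟩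
  rw [← hS₂]
  linear_combination h₁ + 3 * ε * h₂

/-- The leading coefficient of `H⁶ L³ - (H² P / 3)²`. -/
noncomputable def defect (l₀ w q ε : ℝ) : ℝ :=
  3 / 4 * l₀ ^ 2 + 3 * w - 2 * q + ε * (6 * l₀ * w + l₀ ^ 3 - 3 * l₀ * q)
    + ε ^ 2 * (3 * w ^ 2 + 3 * l₀ ^ 2 * w - q ^ 2) + 3 * ε ^ 3 * l₀ * w ^ 2 + ε ^ 4 * w ^ 3

/-- Both powers begin with `1 + 3 l₀ ε`. This agreement at first order is what the choice of `ψ`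
achieves. -/
lemma cube_sub_sq_eq_defect (l₀ w q ε : ℝ) :
    (1 + l₀ * ε + ε ^ 2 * w) ^ 3 - (1 + 3 / 2 * l₀ * ε + ε ^ 2 * q) ^ 2
      = ε ^ 2 * defect l₀ w q ε := by
  rw [defect]; ring

/-- Compactness of the sphere makes the neighbourhood of `0` uniform in `y`. -/
lemma eventually_forall_pos {G : ℝ → S2 → ℝ} (hG : Continuous fun p : ℝ × S2 => G p.1 p.2)
    (h0 : ∀ y, 0 < G 0 y) : ∀ᶠ ε in 𝓝 (0 : ℝ), ∀ y, 0 < G ε y := by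
  have := isCompact_univ.eventually_forall_of_forall_eventually (x₀ := (0 : ℝ))
    (K := (Set.univ : Set S2)) (P := fun ε y => 0 < G ε y) fun y _ => hG.continuousAt.eventually (lt_mem_nhds (h0 y))
  filter_upwards [this] with ε h y using h y (Set.mem_univ y)

/-! ### Joint continuity in `ε` and the point of the sphere -/

section Continuity

variable {X : Type*} [TopologicalSpace X]

lemma continuous_expansionOperator (m A : ℝ) {φ ψ T tr c b ε : X → ℝ} (h₁ : Continuous φ)
    (h₂ : Continuous ψ) (h₃ : Continuous T) (h₄ : Continuous tr) (h₅ : Continuous c)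
    (h₆ : Continuous b) (h₇ : Continuous ε) :
    Continuous fun x => expansionOperator m A (φ x) (ψ x) (T x) (tr x) (c x) (b x) (ε x) := by
  unfold expansionOperator expansionLapse
  dsimp only
  fun_prop

lemma continuous_lapseRemainder (m A : ℝ) {φ ψ f₃ g₁ g₂ g₃ ε : X → ℝ} (h₁ : Continuous φ)
    (h₂ : Continuous ψ) (h₅ : Continuous f₃) (h₆ : Continuous g₁) (h₇ : Continuous g₂)
    (h₈ : Continuous g₃) (h₉ : Continuous ε) :
    Continuous fun x =>
      lapseRemainder m A (φ x) (ψ x) (f₃ x) (g₁ x) (g₂ x) (g₃ x) (ε x) := by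
  unfold lapseRemainder
  fun_prop

lemma continuous_operatorRemainder (m A k : ℝ) {φ ψ f₁ f₂ f₃ g₁ g₂ g₃ l₀ l₁ b₁ ε : X → ℝ}
    (h₁ : Continuous φ) (h₂ : Continuous ψ) (h₃ : Continuous f₁) (h₄ : Continuous f₂)
    (h₅ : Continuous f₃) (h₆ : Continuous g₁) (h₇ : Continuous g₂) (h₈ : Continuous g₃)
    (h₉ : Continuous l₀) (h₁₀ : Continuous l₁) (h₁₁ : Continuous b₁) (h₁₂ : Continuous ε) :
    Continuous fun x => operatorRemainder m A k (φ x) (ψ x) (f₁ x) (f₂ x) (f₃ x) (g₁ x) (g₂ x)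
      (g₃ x) (l₀ x) (l₁ x) (b₁ x) (ε x) := by
  have := continuous_lapseRemainder m A h₁ h₂ h₅ h₆ h₇ h₈ h₁₂
  unfold operatorRemainder
  dsimp only
  fun_prop

lemma continuous_defect {l₀ w q ε : X → ℝ} (h₁ : Continuous l₀) (h₂ : Continuous w)
    (h₃ : Continuous q) (h₄ : Continuous ε) :
    Continuous fun x => defect (l₀ x) (w x) (q x) (ε x) := by
  unfold defect
  fun_prop

lemma Continuous.trace3 {B : X → R3 →L[ℝ] R3} (hB : Continuous B) :
    Continuous fun x => trace3 (B x) := continuous_trace3.comp hB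

lemma SmoothAngular.continuous_snd {F : R3 → ℝ} (hF : SmoothAngular F) :
    (Continuous fun p : X × S2 => F (p.2 : R3)) ∧
      (Continuous fun p : X × S2 => gradient F (p.2 : R3)) ∧
      Continuous fun p : X × S2 => hessian F (p.2 : R3) :=
  ⟨hF.continuous_restrict.comp _root_.continuous_snd,
    hF.continuous_gradient.comp _root_.continuous_snd,
    hF.continuous_hessian.comp _root_.continuous_snd⟩

end Continuity

/-! ### The expansion evaluated on the barrier -/

section Expansion

variable (F Φ Ψ : R3 → ℝ) (ε : ℝ) (y : S2)

/-- The first difference quotient of `expansionGrad` in `ε`. -/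
noncomputable def gradQuotient : R3 := gradient Φ (y : R3) + (1 / 2 * ε) • gradient Ψ (y : R3)

/-- The first difference quotient of the trace of `expansionHess` in `ε`. -/
noncomputable def traceQuotient : ℝ :=
  trace3 (hessian Φ (y : R3)) + 1 / 2 * ε * trace3 (hessian Ψ (y : R3))

/-- The first difference quotient in `ε` of `expansionHess` evaluated on `expansionGrad`. -/
noncomputable def hessQuotient : ℝ :=
  ⟪hessian F (y : R3) (gradient F (y : R3)), gradQuotient Φ Ψ ε y⟫
    + ⟪hessian F (y : R3) (gradQuotient Φ Ψ ε y), expansionGrad F Φ Ψ ε y⟫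
    + ⟪hessian Φ (y : R3) (expansionGrad F Φ Ψ ε y)
      + (1 / 2 * ε) • hessian Ψ (y : R3) (expansionGrad F Φ Ψ ε y), expansionGrad F Φ Ψ ε y⟫

/-- `lapseRemainder` of the barrier. -/
noncomputable def barrierLapseRemainder (m A : ℝ) : ℝ :=
  lapseRemainder m A (Φ y) (Ψ y)
    ⟪gradient F (y : R3), gradient Ψ y⟫ ⟪gradient Φ (y : R3), gradient Φ y⟫
    ⟪gradient Φ (y : R3), gradient Ψ y⟫ ⟪gradient Ψ (y : R3), gradient Ψ y⟫ ε

/-- `operatorRemainder` of the barrier. -/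
noncomputable def barrierOperatorRemainder (m A k : ℝ) : ℝ :=
  operatorRemainder m A k (Φ y) (Ψ y)
    ⟪gradient F (y : R3), gradient F y⟫ ⟪gradient F (y : R3), gradient Φ y⟫
    ⟪gradient F (y : R3), gradient Ψ y⟫ ⟪gradient Φ (y : R3), gradient Φ y⟫
    ⟪gradient Φ (y : R3), gradient Ψ y⟫ ⟪gradient Ψ (y : R3), gradient Ψ y⟫
    (trace3 (hessian F (y : R3))) (traceQuotient Φ Ψ ε y) (hessQuotient F Φ Ψ ε y) ε

/-- `defect` of the barrier. -/
noncomputable def barrierDefect (m A k : ℝ) : ℝ :=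
  defect (trace3 (hessian F (y : R3))) (k⁻¹ * barrierLapseRemainder F Φ Ψ ε y m A)
    (k⁻¹ / 3 * barrierOperatorRemainder F Φ Ψ ε y m A k) ε

variable {F Φ Ψ ε y}

lemma normSq_expansionGrad : ‖expansionGrad F Φ Ψ ε y‖ ^ 2 = ⟪gradient F (y : R3), gradient F y⟫
    + 2 * ε * ⟪gradient F (y : R3), gradient Φ y⟫
    + ε ^ 2 * (⟪gradient Φ (y : R3), gradient Φ y⟫ + ⟪gradient F (y : R3), gradient Ψ y⟫)
    + ε ^ 3 * ⟪gradient Φ (y : R3), gradient Ψ y⟫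
    + 1 / 4 * ε ^ 4 * ⟪gradient Ψ (y : R3), gradient Ψ y⟫ := by
  rw [← real_inner_self_eq_norm_sq, expansionGrad]
  generalize gradient F (y : R3) = a
  generalize gradient Φ (y : R3) = b
  generalize gradient Ψ (y : R3) = c
  simp only [inner_add_left, inner_add_right, real_inner_smul_left, real_inner_smul_right]
  rw [real_inner_comm a b, real_inner_comm a c, real_inner_comm b c]
  ring

lemma inner_expansionGrad : ⟪gradient F (y : R3) + (2 * ε) • gradient Φ (y : R3)
      + (3 / 2 * ε ^ 2) • gradient Ψ (y : R3), expansionGrad F Φ Ψ ε y⟫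
    = ⟪gradient F (y : R3), gradient F y⟫ + 3 * ε * ⟪gradient F (y : R3), gradient Φ y⟫
    + ε ^ 2 * (2 * ⟪gradient F (y : R3), gradient Ψ y⟫
      + 2 * ⟪gradient Φ (y : R3), gradient Φ y⟫)
    + 5 / 2 * ε ^ 3 * ⟪gradient Φ (y : R3), gradient Ψ y⟫
    + 3 / 4 * ε ^ 4 * ⟪gradient Ψ (y : R3), gradient Ψ y⟫ := by
  rw [expansionGrad]
  generalize gradient F (y : R3) = a
  generalize gradient Φ (y : R3) = b
  generalize gradient Ψ (y : R3) = c
  simp only [inner_add_left, inner_add_right, real_inner_smul_left, real_inner_smul_right]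
  rw [real_inner_comm a b, real_inner_comm a c, real_inner_comm b c]
  ring

lemma trace3_expansionHess : trace3 (expansionHess F Φ Ψ ε y)
    = trace3 (hessian F (y : R3)) + ε * traceQuotient Φ Ψ ε y := by
  rw [expansionHess, traceQuotient]
  simp only [trace3, Fin.sum_univ_three, add_apply, smul_apply, PiLp.add_apply, PiLp.smul_apply,
    smul_eq_mul]
  ring

lemma inner_expansionHess : ⟪expansionHess F Φ Ψ ε y (expansionGrad F Φ Ψ ε y),
      expansionGrad F Φ Ψ ε y⟫
    = ⟪hessian F y (gradient F (y : R3)), gradient F (y : R3)⟫ + ε * hessQuotient F Φ Ψ ε y := by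
  have e : expansionGrad F Φ Ψ ε y = gradient F (y : R3) + ε • gradQuotient Φ Ψ ε y := by
    rw [expansionGrad, gradQuotient]; module
  rw [expansionHess, hessQuotient]
  have h : ⟪hessian F (y : R3) (expansionGrad F Φ Ψ ε y), expansionGrad F Φ Ψ ε y⟫
      = ⟪hessian F y (gradient F (y : R3)), gradient F (y : R3)⟫
        + ε * (⟪hessian F (y : R3) (gradient F (y : R3)), gradQuotient Φ Ψ ε y⟫
          + ⟪hessian F (y : R3) (gradQuotient Φ Ψ ε y), expansionGrad F Φ Ψ ε y⟫) := by
    rw [e]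
    generalize gradient F (y : R3) = a
    simp only [map_add, map_smul, inner_add_left, inner_add_right, real_inner_smul_left,
      real_inner_smul_right]
    ring
  simp only [add_apply, smul_apply, inner_add_left, real_inner_smul_left]
  rw [h]
  ring

lemma continuous_barrierOperator (hF : SmoothAngular F) (hΦ : SmoothAngular Φ)
    (hΨ : SmoothAngular Ψ) (m A : ℝ) :
    Continuous fun p : ℝ × S2 => barrierOperator m A F Φ Ψ p.1 p.2 := by
  obtain ⟨-, d1, e1⟩ := hF.continuous_snd (X := ℝ)
  obtain ⟨c1, d2, e2⟩ := hΦ.continuous_snd (X := ℝ)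
  obtain ⟨c2, d3, e3⟩ := hΨ.continuous_snd (X := ℝ)
  have hτ : Continuous fun p : ℝ × S2 => expansionGrad F Φ Ψ p.1 p.2 := by
    unfold expansionGrad; fun_prop
  have hM : Continuous fun p : ℝ × S2 => expansionHess F Φ Ψ p.1 p.2 := by
    unfold expansionHess; fun_prop
  exact continuous_expansionOperator m A c1 c2 (by fun_prop)
    hM.trace3 (by fun_prop) ((hM.clm_apply hτ).inner hτ) continuous_fst

lemma continuous_barrierDefect (hF : SmoothAngular F) (hΦ : SmoothAngular Φ)
    (hΨ : SmoothAngular Ψ) (m A k : ℝ) :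
    Continuous fun p : ℝ × S2 => barrierDefect F Φ Ψ p.1 p.2 m A k := by
  obtain ⟨-, d1, e1⟩ := hF.continuous_snd (X := ℝ)
  obtain ⟨c1, d2, e2⟩ := hΦ.continuous_snd (X := ℝ)
  obtain ⟨c2, d3, e3⟩ := hΨ.continuous_snd (X := ℝ)
  have hτ : Continuous fun p : ℝ × S2 => expansionGrad F Φ Ψ p.1 p.2 := by
    unfold expansionGrad; fun_prop
  have hσ : Continuous fun p : ℝ × S2 => gradQuotient Φ Ψ p.1 p.2 := by
    unfold gradQuotient; fun_prop
  have t1 := e1.trace3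
  have t2 := e2.trace3
  have t3 := e3.trace3
  have hl : Continuous fun p : ℝ × S2 => traceQuotient Φ Ψ p.1 p.2 := by
    unfold traceQuotient; fun_prop
  have hb : Continuous fun p : ℝ × S2 => hessQuotient F Φ Ψ p.1 p.2 := by
    unfold hessQuotient
    exact (((e1.clm_apply d1).inner hσ).add ((e1.clm_apply hσ).inner hτ)).add
      (((e2.clm_apply hτ).add ((continuous_const.mul continuous_fst).smul
        (e3.clm_apply hτ))).inner hτ)
  have hw : Continuous fun p : ℝ × S2 => barrierLapseRemainder F Φ Ψ p.1 p.2 m A :=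
    continuous_lapseRemainder m A c1 c2 (d1.inner d3) (d2.inner d2) (d2.inner d3) (d3.inner d3)
      continuous_fst
  have hq : Continuous fun p : ℝ × S2 => barrierOperatorRemainder F Φ Ψ p.1 p.2 m A k :=
    continuous_operatorRemainder m A k c1 c2 (d1.inner d1) (d1.inner d2) (d1.inner d3)
      (d2.inner d2) (d2.inner d3) (d3.inner d3) t1 hl hb continuous_fst
  exact continuous_defect t1 (continuous_const.mul hw) (continuous_const.mul hq) continuous_fst

/-- At `ε = 0` the normalized remainders contain `A` only through `6 A / k` and `8 A / k`, and the
defect weights them by `3` and `-2`. The positive balance `18 - 16 = 2` is what makes the barriers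
work. -/
lemma barrierDefect_zero (m A k : ℝ) :
    barrierDefect F Φ Ψ 0 y m A k = barrierDefect F Φ Ψ 0 y m 0 k + 2 * A * k⁻¹ := by
  simp only [barrierDefect, barrierLapseRemainder, barrierOperatorRemainder, defect,
    operatorRemainder, lapseRemainder]
  ring

lemma barrier_expansion {m A k : ℝ} (hk : k ≠ 0)
    (hphi : 2 * Φ y - ⟪gradient F (y : R3), gradient F (y : R3)⟫ = k)
    (hpsi : Ψ y = 1 / 2 * k * trace3 (hessian F (y : R3))
      + ⟪gradient F (y : R3), gradient Φ (y : R3)⟫)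
    (hhess : ⟪hessian F y (gradient F (y : R3)), gradient F (y : R3)⟫
      = ⟪gradient F (y : R3), gradient Φ (y : R3)⟫) :
    k⁻¹ * barrierLapse m A F Φ Ψ ε y
        = 1 + trace3 (hessian F (y : R3)) * ε
          + ε ^ 2 * (k⁻¹ * barrierLapseRemainder F Φ Ψ ε y m A) ∧
      k⁻¹ / 3 * barrierOperator m A F Φ Ψ ε y
        = 1 + 3 / 2 * trace3 (hessian F (y : R3)) * ε
          + ε ^ 2 * (k⁻¹ / 3 * barrierOperatorRemainder F Φ Ψ ε y m A k) := by
  have hH2 : k⁻¹ * k = 1 := inv_mul_cancel₀ hk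
  have hb := inner_expansionHess (F := F) (Φ := Φ) (Ψ := Ψ) (ε := ε) (y := y)
  rw [hhess] at hb
  constructor
  · rw [barrierLapse, expansionLapse_eq hphi hpsi normSq_expansionGrad, barrierLapseRemainder]
    linear_combination (1 + trace3 (hessian F (y : R3)) * ε) * hH2
  · rw [barrierOperator, expansionOperator_eq hphi hpsi normSq_expansionGrad inner_expansionGrad
      trace3_expansionHess hb, barrierOperatorRemainder]
    linear_combination (1 + 3 / 2 * trace3 (hessian F (y : R3)) * ε) * hH2

end Expansion

/-- The barrier is a strict supersolution for large `A` and a strict subsolution for large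
`-A`. -/
lemma exists_barrier_threshold {m k : ℝ} (hk : 0 < k) {F Φ Ψ : R3 → ℝ} (hF : SmoothAngular F)
    (hΦ : SmoothAngular Φ) (hΨ : SmoothAngular Ψ)
    (hphi : ∀ y : S2, 2 * Φ y - ⟪gradient F (y : R3), gradient F (y : R3)⟫ = k)
    (hpsi : ∀ y : S2, Ψ y = 1 / 2 * k * trace3 (hessian F (y : R3))
      + ⟪gradient F (y : R3), gradient Φ (y : R3)⟫)
    (hhess : ∀ y : S2, ⟪hessian F y (gradient F (y : R3)), gradient F (y : R3)⟫
      = ⟪gradient F (y : R3), gradient Φ (y : R3)⟫) :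
    ∃ A₀ : ℝ, ∀ A, A₀ ≤ A →
      (∀ᶠ ε in 𝓝 (0 : ℝ), ε ≠ 0 → ∀ y,
        (barrierOperator m A F Φ Ψ ε y) ^ 2 < 9 * k⁻¹ * (barrierLapse m A F Φ Ψ ε y) ^ 3) ∧
      (∀ᶠ ε in 𝓝 (0 : ℝ), ε ≠ 0 → ∀ y,
        0 < barrierOperator m (-A) F Φ Ψ ε y ∧
        9 * k⁻¹ * (barrierLapse m (-A) F Φ Ψ ε y) ^ 3 < (barrierOperator m (-A) F Φ Ψ ε y) ^ 2) := by
  have hc : Continuous fun y : S2 => barrierDefect F Φ Ψ 0 y m 0 k :=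
    Continuous.comp (g := fun p : ℝ × S2 => barrierDefect F Φ Ψ p.1 p.2 m 0 k)
      (f := fun y : S2 => ((0 : ℝ), y)) (continuous_barrierDefect hF hΦ hΨ m 0 k) (by fun_prop)
  obtain ⟨N, hN⟩ := (isCompact_univ.image hc).isBounded.exists_norm_le
  have hN' : ∀ y, |barrierDefect F Φ Ψ 0 y m 0 k| ≤ N := fun y =>
    hN _ ⟨y, Set.mem_univ y, rfl⟩
  -- Since `k⁻¹ = H₀²` in the application, the sign of the defect decides whether the mean curvature
  -- equation fails from above or from below.
  have hid : ∀ A ε y, k⁻¹ ^ 2 * (9 * k⁻¹ * (barrierLapse m A F Φ Ψ ε y) ^ 3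
      - (barrierOperator m A F Φ Ψ ε y) ^ 2) = 9 * (ε ^ 2 * barrierDefect F Φ Ψ ε y m A k) := by
    intro A ε y
    obtain ⟨e1, e2⟩ := barrier_expansion (m := m) (A := A) (ε := ε) hk.ne' (hphi y) (hpsi y)
      (hhess y)
    rw [barrierDefect, ← cube_sub_sq_eq_defect, ← e1, ← e2]
    ring
  -- From this value on, `2 A / k ≥ 2 N + 2` outweighs the bound `N` on the defect for `A = 0`.
  refine ⟨k * (N + 1), fun A hA => ⟨?_, ?_⟩⟩
  · have h1 := eventually_forall_pos (G := fun ε y => barrierDefect F Φ Ψ ε y m A k)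
        (continuous_barrierDefect hF hΦ hΨ m A k) fun y => by
      rw [barrierDefect_zero]
      have h2 : N + 1 ≤ A * k⁻¹ := by
        rw [← div_eq_mul_inv, le_div_iff₀ hk]; linarith
      linarith [abs_le.mp (hN' y)]
    filter_upwards [h1] with ε hε hε0 y
    have h5 : 0 < 9 * (ε ^ 2 * barrierDefect F Φ Ψ ε y m A k) :=
      mul_pos (by norm_num) (mul_pos (by positivity) (hε y))
    rw [← hid] at h5
    linarith [pos_of_mul_pos_right h5 (by positivity)]
  · have h1 := eventually_forall_pos (G := fun ε y => -barrierDefect F Φ Ψ ε y m (-A) k)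
        (continuous_barrierDefect hF hΦ hΨ m (-A) k).neg fun y => by
      rw [barrierDefect_zero]
      have h2 : N + 1 ≤ A * k⁻¹ := by
        rw [← div_eq_mul_inv, le_div_iff₀ hk]; linarith
      linarith [abs_le.mp (hN' y)]
    -- The inequality between squares is useful for a subsolution only if the operator is positive;
    -- at `ε = 0` it equals `3 k`.
    have h1' := eventually_forall_pos (G := fun ε y => barrierOperator m (-A) F Φ Ψ ε y)
        (continuous_barrierOperator hF hΦ hΨ m (-A)) fun y => by
      have e2 := (barrier_expansion (m := m) (A := -A) (ε := 0) hk.ne' (hphi y) (hpsi y)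
        (hhess y)).2
      have h6 : 0 < k⁻¹ / 3 * barrierOperator m (-A) F Φ Ψ 0 y := by rw [e2]; norm_num
      exact pos_of_mul_pos_right h6 (by positivity)
    filter_upwards [h1, h1'] with ε hε hε' hε0 y
    refine ⟨hε' y, ?_⟩
    have h5 : 0 < 9 * (ε ^ 2 * -barrierDefect F Φ Ψ ε y m (-A) k) :=
      mul_pos (by norm_num) (mul_pos (by positivity) (hε y))
    have h7 : 0 < k⁻¹ ^ 2 * ((barrierOperator m (-A) F Φ Ψ ε y) ^ 2
        - 9 * k⁻¹ * (barrierLapse m (-A) F Φ Ψ ε y) ^ 3) := by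
      linarith [hid (-A) ε y]
    linarith [pos_of_mul_pos_right h7 (by positivity)]

/-! ### Comparison with the barriers -/

/-- The maximum over the compact annulus is attained and, by `hint`, only on the boundary spheres.
-/
lemma annulus_nonpos {w : R3 → ℝ} {a b : ℝ}
    (hw : ContinuousOn w {x : R3 | a ≤ ‖x‖ ∧ ‖x‖ ≤ b}) (ha : ∀ x, ‖x‖ = a → w x ≤ 0)
    (hb : ∀ x, ‖x‖ = b → w x ≤ 0) (hint : ∀ x, a < ‖x‖ → ‖x‖ < b → ¬ IsLocalMax w x) (x : R3)
    (h1 : a ≤ ‖x‖) (h2 : ‖x‖ ≤ b) : w x ≤ 0 := by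
  have hK : IsCompact {x : R3 | a ≤ ‖x‖ ∧ ‖x‖ ≤ b} := by
    refine (isCompact_closedBall (0 : R3) b).of_isClosed_subset ?_ fun z hz => by simpa using hz.2
    exact (isClosed_le continuous_const continuous_norm).inter
      (isClosed_le continuous_norm continuous_const)
  obtain ⟨z, hz, hmax⟩ := hK.exists_isMaxOn ⟨x, h1, h2⟩ hw
  refine (hmax ⟨h1, h2⟩ : w x ≤ w z).trans ?_
  rcases hz.1.eq_or_lt with h3 | h3
  · exact ha z h3.symm
  rcases hz.2.eq_or_lt with h4 | h4
  · exact hb z h4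
  refine absurd ?_ (hint z h3 h4)
  filter_upwards [(isOpen_lt continuous_const continuous_norm).mem_nhds h3,
    (isOpen_lt continuous_norm continuous_const).mem_nhds h4] with v hv1 hv2
  exact hmax ⟨le_of_lt hv1, le_of_lt hv2⟩

section Comparison

variable {m r₀ H A r : ℝ} {u F Φ Ψ : R3 → ℝ} (hm : 0 < m) (hr₀ : 2 * m ≤ r₀)
  (hu : IsSpacelikeCMCGraph m r₀ H u) (hF : SmoothAngular F) (hΦ : SmoothAngular Φ)
  (hΨ : SmoothAngular Ψ)

include hu in
lemma IsSpacelikeCMCGraph.contDiffAt {x : R3} (hx : r₀ < ‖x‖) : ContDiffAt ℝ 2 u x :=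
  hu.contDiffOn.contDiffAt ((isOpen_lt continuous_const continuous_norm).mem_nhds hx)

include hm hr₀ hu in
lemma IsSpacelikeCMCGraph.equation {x g : R3} {B : R3 →L[ℝ] R3} (hx : r₀ < ‖x‖)
    (hJ : HasJet2 u x g B) : 0 < lapseSq m x g ∧
      3 * H * (lapseSq m x g * √(lapseSq m x g)) = mcPrincipal m x g B + mcLower m x g :=
  HasMeanCurvatureAt.equation hm (by linarith) hJ (hu.cmc x hx)

include hm hr₀ hu hF hΦ hΨ

/-- At such a maximum the gradients coincide and the Hessian of `u` is at most that of the barrier,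
so ellipticity gives `3 H L^{3/2} ≤ P`, against the strict inequality. -/
lemma not_isLocalMax_sub_barrier (hH : 0 < H) (hr : r₀ < r) (y : S2)
    (hlt : (barrierOperator m A F Φ Ψ r⁻¹ y) ^ 2
      < 9 * H ^ 2 * (barrierLapse m A F Φ Ψ r⁻¹ y) ^ 3) :
    ¬ IsLocalMax (fun z => u z - barrier m A F Φ Ψ z) (r • (y : R3)) := by
  intro hmax
  have r0 : 0 < r := by linarith
  have hx : ‖r • (y : R3)‖ = r := by simp [norm_smul, abs_of_pos r0]
  have hju := hasJet2_of_contDiffAt (hu.contDiffAt (x := r • (y : R3)) (by rwa [hx]))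
  obtain ⟨g, B, hJ, hw, hop⟩ := mcOperator_barrier (A := A) hF hΦ hΨ hm
    (by linarith : 2 * m < r) y
  obtain ⟨h1, h2⟩ := (hju.sub hJ).of_isLocalMax hmax
  rw [sub_eq_zero.mp h1] at hju
  -- With the common gradient, the positivity of `lapseSq` for `u` passes to the barrier, which need
  -- not be spacelike elsewhere.
  obtain ⟨hpos, heq⟩ := hu.equation hm hr₀ (by rwa [hx]) hju
  have hle := mcPrincipal_mono hm (by rw [hx]; linarith) hpos.le h2
  have ε0 : 0 < r⁻¹ := inv_pos.mpr r0
  rw [hw] at hpos heq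
  have hL := pos_of_mul_pos_right hpos (by positivity)
  rw [Real.sqrt_mul (by positivity), Real.sqrt_sq ε0.le] at heq
  generalize barrierLapse m A F Φ Ψ r⁻¹ y = L at *
  generalize barrierOperator m A F Φ Ψ r⁻¹ y = P at *
  have h3 : 3 * H * (L * √L) ≤ P := by
    refine le_of_mul_le_mul_left ?_ (pow_pos ε0 3)
    calc r⁻¹ ^ 3 * (3 * H * (L * √L)) = 3 * H * (r⁻¹ ^ 2 * L * (r⁻¹ * √L)) := by ring
      _ ≤ r⁻¹ ^ 3 * P := by rw [heq, ← hop]; linarith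
  have h4 : (3 * H * (L * √L)) ^ 2 ≤ P ^ 2 := pow_le_pow_left₀ (by positivity) h3 2
  have h5 : (3 * H * (L * √L)) ^ 2 = 9 * H ^ 2 * L ^ 3 := by
    have := Real.sq_sqrt hL.le
    calc (3 * H * (L * √L)) ^ 2 = 9 * H ^ 2 * L ^ 2 * √L ^ 2 := by ring
      _ = _ := by rw [this]; ring
  linarith

lemma not_isLocalMax_barrier_sub (hr : r₀ < r) (y : S2)
    (hP : 0 < barrierOperator m A F Φ Ψ r⁻¹ y)
    (hlt : 9 * H ^ 2 * (barrierLapse m A F Φ Ψ r⁻¹ y) ^ 3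
      < (barrierOperator m A F Φ Ψ r⁻¹ y) ^ 2) :
    ¬ IsLocalMax (fun z => barrier m A F Φ Ψ z - u z) (r • (y : R3)) := by
  intro hmax
  have r0 : 0 < r := by linarith
  have hx : ‖r • (y : R3)‖ = r := by simp [norm_smul, abs_of_pos r0]
  have hju := hasJet2_of_contDiffAt (hu.contDiffAt (x := r • (y : R3)) (by rwa [hx]))
  obtain ⟨g, B, hJ, hw, hop⟩ := mcOperator_barrier (A := A) hF hΦ hΨ hm
    (by linarith : 2 * m < r) y
  obtain ⟨h1, h2⟩ := (hJ.sub hju).of_isLocalMax hmax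
  rw [← sub_eq_zero.mp h1] at hju
  obtain ⟨hpos, heq⟩ := hu.equation hm hr₀ (by rwa [hx]) hju
  have hle := mcPrincipal_mono hm (by rw [hx]; linarith) hpos.le h2
  have ε0 : 0 < r⁻¹ := inv_pos.mpr r0
  rw [hw] at hpos heq
  have hL := pos_of_mul_pos_right hpos (by positivity)
  rw [Real.sqrt_mul (by positivity), Real.sqrt_sq ε0.le] at heq
  generalize barrierLapse m A F Φ Ψ r⁻¹ y = L at *
  generalize barrierOperator m A F Φ Ψ r⁻¹ y = P at *
  have h3 : P ≤ 3 * H * (L * √L) := by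
    refine le_of_mul_le_mul_left ?_ (pow_pos ε0 3)
    calc r⁻¹ ^ 3 * P ≤ 3 * H * (r⁻¹ ^ 2 * L * (r⁻¹ * √L)) := by rw [heq, ← hop]; linarith
      _ = r⁻¹ ^ 3 * (3 * H * (L * √L)) := by ring
  -- Here `P` is the smaller side, so squaring needs `P` nonnegative.
  have h4 : P ^ 2 ≤ (3 * H * (L * √L)) ^ 2 := pow_le_pow_left₀ hP.le h3 2
  have h5 : (3 * H * (L * √L)) ^ 2 = 9 * H ^ 2 * L ^ 3 := by
    have := Real.sq_sqrt hL.le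
    calc (3 * H * (L * √L)) ^ 2 = 9 * H ^ 2 * L ^ 2 * √L ^ 2 := by ring
      _ = _ := by rw [this]; ring
  linarith

omit hr₀ in
lemma continuousOn_sub_barrier {a b : ℝ} (ha : r₀ < a) (ha' : 2 * m < a) :
    ContinuousOn (fun z => u z - barrier m A F Φ Ψ z) {x : R3 | a ≤ ‖x‖ ∧ ‖x‖ ≤ b} := by
  intro x hx
  have h0 : 0 < ‖x‖ := by linarith [hx.1]
  have hx' : ‖x‖⁻¹ • x ∈ Metric.sphere (0 : R3) 1 := inv_norm_smul_mem_S2 (norm_pos_iff.mp h0)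
  obtain ⟨B, hJ, -⟩ := hasJet2_barrier (A := A) hF hΦ hΨ hm
    (by linarith [hx.1] : 2 * m < ‖x‖) ⟨_, hx'⟩
  have e : ‖x‖ • ‖x‖⁻¹ • x = x := by rw [smul_smul, mul_inv_cancel₀ h0.ne', one_smul]
  have hc := hJ.hasFDerivAt.continuousAt
  simp only [e] at hc
  exact ((hu.contDiffAt (by linarith [hx.1])).continuousAt.sub hc).continuousWithinAt

end Comparison

/-! ### Proof of the theorem -/

lemma barrier_smul (m A : ℝ) (f φ ψ : S2 → ℝ) {r : ℝ} (hr : 0 < r) (y : S2) :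
    barrier m A (radialExt f) (radialExt φ) (radialExt ψ) (r • (y : R3))
      = rStar m r + A * (r ^ 3)⁻¹ + f y + r⁻¹ * φ y + (1 / 2) * (r ^ 2)⁻¹ * ψ y := by
  have hx : ‖r • (y : R3)‖ = r := by simp [norm_smul, abs_of_pos hr]
  simp only [barrier, hx, radialExt_smul _ hr, radialExt_coe]

lemma exists_eq_smul_of_norm_pos {x : R3} (hx : 0 < ‖x‖) : ∃ y : S2, x = ‖x‖ • (y : R3) :=
  ⟨⟨_, inv_norm_smul_mem_S2 (norm_pos_iff.mp hx)⟩, by simp [smul_smul, hx.ne']⟩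

lemma exists_forall_inv_of_eventually {p : ℝ → Prop} (h : ∀ᶠ ε in 𝓝 (0 : ℝ), ε ≠ 0 → p ε) :
    ∃ R : ℝ, 0 < R ∧ ∀ r, R < r → p r⁻¹ := by
  obtain ⟨R, hR⟩ := Filter.eventually_atTop.mp (tendsto_inv_atTop_zero.eventually h)
  refine ⟨max R 1, by positivity, fun r hr => hR r ((le_max_left _ _).trans hr.le) ?_⟩
  have : 0 < r := lt_trans (by positivity) hr
  positivity

theorem mainTheorem5 (m H₀ r₀ : ℝ) (hm : 0 < m) (hH₀ : 0 < H₀) (hr₀ : 2 * m ≤ r₀)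
    (f : S2 → ℝ) (hf : ContMDiff (𝓡 2) 𝓘(ℝ, ℝ) ∞ f)
    (u : R3 → ℝ) (hu : IsSpacelikeCMCGraph m r₀ H₀ u)
    (hlim : ∀ y : S2, Filter.Tendsto (fun r : ℝ => u (r • (y : R3)) - rStar m r)
      Filter.atTop (nhds (f y))) :
    ((∃ C : ℝ, 0 < C ∧ ∃ r : ℕ → ℝ, (∀ i, r₀ < r i) ∧ Filter.Tendsto r Filter.atTop Filter.atTop ∧
        ∀ (i : ℕ) (y : S2),
          u (r i • (y : R3)) - rStar m (r i)
            - (f y + (r i)⁻¹ * phi H₀ f y + (1 / 2) * (r i ^ 2)⁻¹ * psi H₀ f y)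
            ≤ C * (r i ^ 3)⁻¹) →
      ∃ C' : ℝ, 0 < C' ∧ ∃ R : ℝ, r₀ ≤ R ∧ ∀ (r : ℝ), R < r → ∀ y : S2,
          u (r • (y : R3)) - rStar m r
            - (f y + r⁻¹ * phi H₀ f y + (1 / 2) * (r ^ 2)⁻¹ * psi H₀ f y)
            ≤ C' * (r ^ 3)⁻¹) ∧
    ((∃ C : ℝ, 0 < C ∧ ∃ r : ℕ → ℝ, (∀ i, r₀ < r i) ∧ Filter.Tendsto r Filter.atTop Filter.atTop ∧
        ∀ (i : ℕ) (y : S2),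
          -(C * (r i ^ 3)⁻¹) ≤
            u (r i • (y : R3)) - rStar m (r i)
              - (f y + (r i)⁻¹ * phi H₀ f y + (1 / 2) * (r i ^ 2)⁻¹ * psi H₀ f y)) →
      ∃ C' : ℝ, 0 < C' ∧ ∃ R : ℝ, r₀ ≤ R ∧ ∀ (r : ℝ), R < r → ∀ y : S2,
          -(C' * (r ^ 3)⁻¹) ≤
            u (r • (y : R3)) - rStar m r
              - (f y + r⁻¹ * phi H₀ f y + (1 / 2) * (r ^ 2)⁻¹ * psi H₀ f y)) := by
  have hF := smoothAngular_radialExt hf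
  have hΦ := smoothAngular_phi (H := H₀) hF
  have hΨ := smoothAngular_psi (H := H₀) hF
  obtain ⟨A₀, hA₀⟩ := exists_barrier_threshold (m := m) (k := (H₀ ^ 2)⁻¹) (by positivity) hF hΦ hΨ
    (fun y => by rw [radialExt_coe, phi, sphereGrad, real_inner_self_eq_norm_sq]; ring)
    (fun y => by rw [radialExt_coe, psi_eq hF]) (inner_hessian_gradient hF)
  -- This turns `k⁻¹` into `H₀ ^ 2`, the form in which the comparison lemmas take the inequality.
  rw [inv_inv] at hA₀
  constructor
  · rintro ⟨C, hC, r, hr, hlimr, hle⟩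
    -- The constant `max A₀ C` is past the threshold and also dominates the given bound, so the
    -- barrier lies above `u` on every sphere of radius `r l`.
    obtain ⟨R₁, hR₁, hbar⟩ := exists_forall_inv_of_eventually (hA₀ (max A₀ C) (le_max_left _ _)).1
    obtain ⟨i, hi⟩ := (hlimr.eventually_gt_atTop R₁).exists
    refine ⟨max A₀ C, lt_max_of_lt_right hC, r i, (hr i).le, fun s hs y => ?_⟩
    -- The outer sphere depends on `s`, but the barrier and the inner sphere do not; the bound
    -- obtained is therefore uniform.
    obtain ⟨j, hj⟩ := (hlimr.eventually_gt_atTop s).exists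
    have hbd : ∀ l, ∀ x : R3, ‖x‖ = r l → u x - barrier m (max A₀ C) (radialExt f)
        (radialExt (phi H₀ f)) (radialExt (psi H₀ f)) x ≤ 0 := by
      intro l x hx
      have hl : 0 < r l := by linarith [hr l]
      obtain ⟨z, hz⟩ := exists_eq_smul_of_norm_pos (hx ▸ hl)
      rw [hz, hx, barrier_smul _ _ _ _ _ hl]
      have h1 : C * (r l ^ 3)⁻¹ ≤ max A₀ C * (r l ^ 3)⁻¹ :=
        mul_le_mul_of_nonneg_right (le_max_right _ _) (by positivity)
      linarith [hle l z]
    have s0 : 0 < s := by linarith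
    have hs' : ‖s • (y : R3)‖ = s := by simp [norm_smul, abs_of_pos s0]
    have key := annulus_nonpos (continuousOn_sub_barrier (b := r j) hm hu hF hΦ hΨ (hr i)
      (by linarith [hr i])) (hbd i) (hbd j) (fun x h1 h2 => by
        obtain ⟨z, hz⟩ := exists_eq_smul_of_norm_pos (x := x) (by linarith)
        rw [hz]
        exact not_isLocalMax_sub_barrier hm hr₀ hu hF hΦ hΨ hH₀ (by linarith [hr i]) z
          (hbar ‖x‖ (by linarith) z)) (s • (y : R3)) (by linarith) (by linarith)
    rw [barrier_smul _ _ _ _ _ s0] at key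
    linarith
  · rintro ⟨C, hC, r, hr, hlimr, hle⟩
    -- The same argument from below, with the subsolution whose last coefficient is `-max A₀ C`.
    obtain ⟨R₁, hR₁, hbar⟩ := exists_forall_inv_of_eventually (hA₀ (max A₀ C) (le_max_left _ _)).2
    obtain ⟨i, hi⟩ := (hlimr.eventually_gt_atTop R₁).exists
    refine ⟨max A₀ C, lt_max_of_lt_right hC, r i, (hr i).le, fun s hs y => ?_⟩
    obtain ⟨j, hj⟩ := (hlimr.eventually_gt_atTop s).exists
    have hbd : ∀ l, ∀ x : R3, ‖x‖ = r l → barrier m (-max A₀ C) (radialExt f)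
        (radialExt (phi H₀ f)) (radialExt (psi H₀ f)) x - u x ≤ 0 := by
      intro l x hx
      have hl : 0 < r l := by linarith [hr l]
      obtain ⟨z, hz⟩ := exists_eq_smul_of_norm_pos (hx ▸ hl)
      rw [hz, hx, barrier_smul _ _ _ _ _ hl]
      have h1 : C * (r l ^ 3)⁻¹ ≤ max A₀ C * (r l ^ 3)⁻¹ :=
        mul_le_mul_of_nonneg_right (le_max_right _ _) (by positivity)
      linarith [hle l z]
    have s0 : 0 < s := by linarith
    have hs' : ‖s • (y : R3)‖ = s := by simp [norm_smul, abs_of_pos s0]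
    have hcont := (continuousOn_sub_barrier (A := -max A₀ C) (b := r j) hm hu hF hΦ hΨ (hr i)
      (by linarith [hr i])).neg
    have key := annulus_nonpos (hcont.congr fun x _ => by simp) (hbd i) (hbd j)
      (fun x h1 h2 => by
        obtain ⟨z, hz⟩ := exists_eq_smul_of_norm_pos (x := x) (by linarith)
        rw [hz]
        have h3 := hbar ‖x‖ (by linarith) z
        exact not_isLocalMax_barrier_sub hm hr₀ hu hF hΦ hΨ (by linarith [hr i]) z h3.1
          h3.2) (s • (y : R3)) (by linarith) (by linarith)
    rw [barrier_smul _ _ _ _ _ s0] at key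
    linarith
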